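/- Let $p,q$ be coprime integers with $0<p<q$, and let $T(p,q)\subset S^3$ be the (positive) $(p,q)$-torus knot, i.e. the knot that wraps around the standard solid torus $p$ times in the longitudinal and $q$ times in the meridional direction; equivalently, $T(p,q)$ is the closure of the braid $(\sigma_1\cdots\sigma_{p-1})^q$ on $p$ strands, with all crossings positive. If $T(p,q)$ is neither a trivial knot nor $T(2,3)$, then $$\sigma_d(T(p,q))\le -4\qquad\text{for every prime } d .$$ Here $\sigma_d(K)$ is Tristram's $d$-signature of an oriented knot $K$: the signature of the Hermitian matrix $(1-\omega)V+(1-\overline{\omega})V^{T}$, where $V$ is a Seifert matrix of $K$ and $\omega=e^{2\pi i[d/2]/d}$, with $[x]$ the greatest integer not exceeding $x$; the sign convention is that positive crossings make the signature negative, so that $\sigma_d(T(2,3))=-2$. -/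

import Mathlib

open scoped Matrix ComplexConjugate

/-!
Oriented knots and links in the 3-sphere are presented here as closed braids. By the theorems of
Alexander and Markov, every oriented link is the closure of a braid, and two braids have isotopic
closures if and only if they are related by the relations of the braid group, conjugation and
stabilization.
-/

/-- A closed braid on `gens + 1` strands. The letter `(i, 1)` of `word` stands for the generator
which lets the strands in positions `i` and `i + 1` cross once, with a positive crossing; the
letter `(i, -1)` stands for its inverse, which is a negative crossing. (Positions are counted
from `0`; all strands are oriented in the same direction around the braid axis.) -/
structure ClosedBraid where
  /-- The number of generators; the number of strands is one more. -/
  gens : ℕ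
  /-- The crossings, in the order in which they are met around the braid axis. -/
  word : List (Fin gens × ℤˣ)

namespace ClosedBraid

/-- The elementary moves between closed braids that do not change the isotopy class of the
closure: the relations of the braid group, conjugation, and stabilization. -/
inductive Move : ClosedBraid → ClosedBraid → Prop
  /-- A generator and its inverse cancel. -/
  | cancel (r : ℕ) (u v : List (Fin r × ℤˣ)) (i : Fin r) (ε : ℤˣ) :
      Move ⟨r, u ++ [(i, ε), (i, -ε)] ++ v⟩ ⟨r, u ++ v⟩
  /-- Generators at distance at least two commute. -/
  | comm (r : ℕ) (u v : List (Fin r × ℤˣ)) (i j : Fin r) (ε δ : ℤˣ)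
      (hij : (i : ℕ) + 1 < j) :
      Move ⟨r, u ++ [(i, ε), (j, δ)] ++ v⟩ ⟨r, u ++ [(j, δ), (i, ε)] ++ v⟩
  /-- The braid relation between neighbouring generators. -/
  | braid (r : ℕ) (u v : List (Fin r × ℤˣ)) (i j : Fin r) (hij : (i : ℕ) + 1 = j) :
      Move ⟨r, u ++ [(i, 1), (j, 1), (i, 1)] ++ v⟩ ⟨r, u ++ [(j, 1), (i, 1), (j, 1)] ++ v⟩
  /-- Conjugation by a letter. -/
  | conj (r : ℕ) (u : List (Fin r × ℤˣ)) (a : Fin r × ℤˣ) :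
      Move ⟨r, a :: u⟩ ⟨r, u ++ [a]⟩
  /-- Stabilization: a new last strand and one crossing, of either sign, with it. -/
  | stab (r : ℕ) (u : List (Fin r × ℤˣ)) (ε : ℤˣ) :
      Move ⟨r, u⟩ ⟨r + 1, u.map (fun a => (a.1.castSucc, a.2)) ++ [(Fin.last r, ε)]⟩

/-- Two closed braids are the same oriented link (up to isotopy in the 3-sphere): they are joined
by a finite sequence of elementary moves and their inverses. -/
def Isotopic : ClosedBraid → ClosedBraid → Prop :=
  Relation.EqvGen Move

/-- The trivial knot: the closure of the braid with one strand. -/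
def trivialKnot : ClosedBraid := ⟨0, []⟩

/-- The torus knot `T(p, q)`, for coprime `p, q > 0`: the closure of the braid `(σ₁ ⋯ σ_{p-1})^q`
on `p` strands. It runs `p` times in the longitudinal and `q` times in the meridional direction
of the standard solid torus, and all its crossings are positive. -/
def torusKnot (p q : ℕ) : ClosedBraid :=
  ⟨p - 1, (List.replicate q (List.ofFn fun i : Fin (p - 1) => (i, (1 : ℤˣ)))).flatten⟩

section Seifert

variable (β : ClosedBraid)

/-!
The Seifert surface `F` that Seifert's algorithm builds from the diagram of a closed braid has one
disc for every strand position and one half twisted band for every crossing; the discs are parallel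
to one another, stacked along the braid axis, and the bands are attached along their boundaries in
the order of the word. The surface `F` retracts to the graph with one vertex for every disc and one
edge for every band, so that `H₁(F; ℂ)` is the kernel of the boundary map of this graph.
-/

/-- The position of the `k`-th crossing: its band joins disc `i` to disc `i + 1`. -/
def pos (k : Fin β.word.length) : Fin β.gens := (β.word.get k).1

/-- The sign of the `k`-th crossing. -/
def sgn (k : Fin β.word.length) : ℤˣ := (β.word.get k).2

/-- The boundary map of the graph of discs and bands: the `k`-th band runs from disc `i` to
disc `i + 1`, where `i` is the position of the `k`-th crossing. -/
noncomputable def boundary :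
    (Fin β.word.length → ℂ) →ₗ[ℂ] (Fin (β.gens + 1) → ℂ) :=
  Fintype.linearCombination ℂ
    (fun k => Pi.single (β.pos k).succ (1 : ℂ) - Pi.single (β.pos k).castSucc (1 : ℂ))

/-- The first homology `H₁(F; ℂ)` of the Seifert surface, as the space of cycles of the graph. -/
noncomputable def homology : Submodule ℂ (Fin β.word.length → ℂ) :=
  LinearMap.ker β.boundary

/-- The Seifert pairing `(x, y) ↦ lk(x, y⁺)` of the Seifert surface, where `y⁺` is `y` pushed off
the surface in the positive normal direction: for cycles `x, y` it is the number
`∑ k l, x k * linking k l * y l`.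

The linking number is half the number of signed crossings between `x` and `y⁺` in the projection
along the braid axis. Two parallel arcs through one band contribute `-1/2` or `1/2` according to
the half twist of this band. The arcs within the discs meet like chords of a circle whose ends lie
in the order of the word, and since the discs are stacked and cycles have no boundary, the
contributions of all pairs of discs add up to `±1/2` for two bands in the same position,
antisymmetrically, to `-1` for two bands in neighbouring positions, the upper of which comes
first, and to `0` otherwise.

For example, let `x` be the loop through two consecutive bands `k < l` in one position (up `k`
and down `l`), and `y` the loop through the next two consecutive bands `l < m` of this position.
Then `lk(x, x⁺) = -(ε k + ε l) / 2`, `lk(x, y⁺) = (ε l + 1) / 2` and `lk(y, x⁺) = (ε l - 1) / 2`,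
with `ε` the signs. -/
def linking : Matrix (Fin β.word.length) (Fin β.word.length) ℚ :=
  Matrix.of fun k l =>
    if k = l then -(((β.sgn k : ℤ) : ℚ) / 2)
    else if β.pos k = β.pos l then (if k < l then 1 / 2 else -(1 / 2))
    else if k < l ∧ (β.pos k : ℕ) = (β.pos l : ℕ) + 1 then -1
    else 0

/-- The matrix `(1 - ω) V + (1 - conj ω) Vᵀ` of the Hermitian form defined by the Seifert
pairing `V` and a complex number `ω`. -/
noncomputable def hermitianMatrix (ω : ℂ) :
    Matrix (Fin β.word.length) (Fin β.word.length) ℂ :=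
  (1 - ω) • β.linking.map (fun a : ℚ => (a : ℂ)) +
    (1 - conj ω) • (β.linking.map (fun a : ℚ => (a : ℂ)))ᵀ

theorem hermitianMatrix_isHermitian (ω : ℂ) : (β.hermitianMatrix ω).IsHermitian := by
  ext k l
  simp [hermitianMatrix, Matrix.conjTranspose_apply, add_comm]

end Seifert

end ClosedBraid

/-- The positive index of inertia of the Hermitian form `x ↦ xᴴ A x` on the subspace `Z`: the
largest dimension of a subspace of `Z` on which the form is positive definite. -/
noncomputable def positiveIndex {ι : Type*} [Fintype ι] (A : Matrix ι ι ℂ)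
    (Z : Submodule ℂ (ι → ℂ)) : ℕ :=
  sSup {k : ℕ | ∃ W : Submodule ℂ (ι → ℂ), W ≤ Z ∧ Module.finrank ℂ W = k ∧
    ∀ x ∈ W, x ≠ 0 → 0 < (star x ⬝ᵥ (A *ᵥ x)).re}

/-- The signature of the Hermitian form `x ↦ xᴴ A x` on the subspace `Z`: the positive index of
inertia minus the negative one. -/
noncomputable def hermitianSignature {ι : Type*} [Fintype ι] (A : Matrix ι ι ℂ)
    (Z : Submodule ℂ (ι → ℂ)) : ℤ :=
  (positiveIndex A Z : ℤ) - (positiveIndex (-A) Z : ℤ)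

/-- Tristram's `d`-signature: the signature of the Hermitian form `(1 - ω) V + (1 - conj ω) Vᵀ` on
the first homology of a Seifert surface, where `V` is the Seifert pairing and
`ω = exp(2πi [d/2] / d)`. For `d = 2` we have `ω = -1`, and this is the ordinary signature. -/
noncomputable def ClosedBraid.tristramSignature (d : ℕ) (β : ClosedBraid) : ℤ :=
  hermitianSignature
    (β.hermitianMatrix (Complex.exp (2 * Real.pi * Complex.I * ((d / 2 : ℕ) : ℂ) / (d : ℂ))))
    β.homology

/-!
The signature `σ_ω` of the form `(1 - ω) V + (1 - conj ω) Vᵀ` is an isotopy invariant for every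
`ω ≠ 1`, so that it suffices to estimate it on the standard braid `(σ₁ ⋯ σ_{p-1})^q`.

*Invariance.* A vector on the bands is a cycle if and only if its total weight (`flux`) at each
position vanishes, and the part of the Seifert pairing between two subwords depends only on these
total weights (`seifert_append`). Hence a braid relation reduces to an isometry between the vectors
on two short words that keeps the weights (`signatureAt_replace`), and conjugation to a sign
computation (`signatureAt_append_comm`). The cancellation of a letter with its inverse divides out
an isotropic vector: one passes to its orthogonal complement, which does not change the signature
(`hermitianSignature_orthogonalWithin`), because a hyperbolic plane has signature zero.

*Torus links.* On the cycles, the Seifert pairing of `(σ₁ ⋯ σ_{p-1})^q` is the tensor product of two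
bidiagonal pairings (`seifert_torusVector`), both of which are diagonalized by roots of unity. The
vectors `(z ^ (i + 1) - 1) * s ^ j` with `z = exp (2πi c / p) ≠ 1` and `s = exp (2πi a / q) ≠ 1` are
orthogonal for the Hermitian form, and for `ω = exp (2πi x)` the value at such a vector is a
negative multiple of `sin (π (x - c / p + a / q))`. This is the formula of Brieskorn and
Litherland. Since there are at most `(p - 1) (q - 1)` dimensions, `b` pairs `(c, a)` whose value is
not negative give `σ_ω ≤ 2 b - (p - 1) (q - 1)`.

*Counting.* Here `1/3 ≤ x ≤ 1/2`. For given `c` at most `q |c / p - x|` of the `a` are exceptional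
(`card_exceptional_le`), and by convexity the sum of `|c / p - x|` is at most
`p ∫ |s - x| ds ≤ 5 p / 18` (`sum_abs_sub_le`). This suffices for `p ≥ 6`; for `p ≤ 5` the sum is
computed, and the integrality of `b` settles `T(2, 5)`, `T(2, 7)` and `T(3, 4)`
(`four_le_sub_of_le`).
-/

/-! ### The index of inertia of a Hermitian form on a subspace -/

section Inertia

variable {ι κ : Type*} [Fintype ι] [Fintype κ]

theorem bddAbove_positiveIndex (A : Matrix ι ι ℂ) (Z : Submodule ℂ (ι → ℂ)) :
    BddAbove {k : ℕ | ∃ W : Submodule ℂ (ι → ℂ), W ≤ Z ∧ Module.finrank ℂ W = k ∧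
      ∀ x ∈ W, x ≠ 0 → 0 < (star x ⬝ᵥ (A *ᵥ x)).re} := by
  refine ⟨Module.finrank ℂ (ι → ℂ), ?_⟩
  rintro k ⟨W, -, rfl, -⟩
  exact Submodule.finrank_le W

theorem le_positiveIndex {A : Matrix ι ι ℂ} {Z W : Submodule ℂ (ι → ℂ)} (hW : W ≤ Z)
    (hpos : ∀ x ∈ W, x ≠ 0 → 0 < (star x ⬝ᵥ (A *ᵥ x)).re) :
    Module.finrank ℂ W ≤ positiveIndex A Z :=
  le_csSup (bddAbove_positiveIndex A Z) ⟨W, hW, rfl, hpos⟩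

theorem exists_finrank_eq_positiveIndex (A : Matrix ι ι ℂ) (Z : Submodule ℂ (ι → ℂ)) :
    ∃ W : Submodule ℂ (ι → ℂ), W ≤ Z ∧ Module.finrank ℂ W = positiveIndex A Z ∧
      ∀ x ∈ W, x ≠ 0 → 0 < (star x ⬝ᵥ (A *ᵥ x)).re :=
  Nat.sSup_mem (s := {k : ℕ | ∃ W : Submodule ℂ (ι → ℂ), W ≤ Z ∧ Module.finrank ℂ W = k ∧
      ∀ x ∈ W, x ≠ 0 → 0 < (star x ⬝ᵥ (A *ᵥ x)).re})
    ⟨0, ⊥, bot_le, finrank_bot ℂ _, fun _ hx hx0 => absurd ((Submodule.mem_bot ℂ).1 hx) hx0⟩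
    (bddAbove_positiveIndex A Z)

/-- A linear map that does not decrease the form can only increase the positive index; it is
automatically injective on positive definite subspaces. -/
theorem positiveIndex_le_of_map {A : Matrix ι ι ℂ} {B : Matrix κ κ ℂ}
    {Z : Submodule ℂ (ι → ℂ)} {Y : Submodule ℂ (κ → ℂ)} (T : (ι → ℂ) →ₗ[ℂ] (κ → ℂ))
    (hT : ∀ x ∈ Z, T x ∈ Y)
    (hAB : ∀ x ∈ Z, (star x ⬝ᵥ (A *ᵥ x)).re ≤ (star (T x) ⬝ᵥ (B *ᵥ T x)).re) :
    positiveIndex A Z ≤ positiveIndex B Y := by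
  obtain ⟨W, hWZ, hW, hpos⟩ := exists_finrank_eq_positiveIndex A Z
  have hinj : Function.Injective (T.domRestrict W) := by
    rw [← LinearMap.ker_eq_bot, LinearMap.ker_eq_bot']
    rintro ⟨x, hx⟩ hTx
    by_contra hne
    have h := (hpos x hx (fun h => hne (by simpa using h))).trans_le (hAB x (hWZ hx))
    rw [show T x = 0 from hTx] at h
    simp at h
  rw [← hW, ← LinearMap.finrank_range_of_inj hinj]
  refine le_positiveIndex ?_ ?_
  · rintro _ ⟨⟨x, hx⟩, rfl⟩
    exact hT x (hWZ hx)
  · rintro _ ⟨⟨x, hx⟩, rfl⟩ hne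
    refine (hpos x hx ?_).trans_le (hAB x (hWZ hx))
    rintro rfl
    exact hne (map_zero T)

theorem neg_form_re (A : Matrix ι ι ℂ) (x : ι → ℂ) :
    (star x ⬝ᵥ ((-A) *ᵥ x)).re = -(star x ⬝ᵥ (A *ᵥ x)).re := by
  simp [Matrix.neg_mulVec]

/-- Two forms have the same signature if there are form preserving maps in both directions. -/
theorem hermitianSignature_eq_of_maps {A : Matrix ι ι ℂ} {B : Matrix κ κ ℂ}
    {Z : Submodule ℂ (ι → ℂ)} {Y : Submodule ℂ (κ → ℂ)}
    (T : (ι → ℂ) →ₗ[ℂ] (κ → ℂ)) (S : (κ → ℂ) →ₗ[ℂ] (ι → ℂ))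
    (hT : ∀ x ∈ Z, T x ∈ Y) (hS : ∀ y ∈ Y, S y ∈ Z)
    (hAT : ∀ x ∈ Z, star (T x) ⬝ᵥ (B *ᵥ T x) = star x ⬝ᵥ (A *ᵥ x))
    (hBS : ∀ y ∈ Y, star (S y) ⬝ᵥ (A *ᵥ S y) = star y ⬝ᵥ (B *ᵥ y)) :
    hermitianSignature A Z = hermitianSignature B Y := by
  unfold hermitianSignature
  rw [(positiveIndex_le_of_map T hT fun x hx => (congrArg Complex.re (hAT x hx)).ge).antisymm
      (positiveIndex_le_of_map S hS fun y hy => (congrArg Complex.re (hBS y hy)).ge),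
    (positiveIndex_le_of_map (A := -A) (B := -B) T hT fun x hx => by
      rw [neg_form_re, neg_form_re, hAT x hx]).antisymm
      (positiveIndex_le_of_map (A := -B) (B := -A) S hS fun y hy => by
      rw [neg_form_re, neg_form_re, hBS y hy])]

theorem positiveIndex_add_positiveIndex_neg_le (A : Matrix ι ι ℂ) (Z : Submodule ℂ (ι → ℂ)) :
    positiveIndex A Z + positiveIndex (-A) Z ≤ Module.finrank ℂ Z := by
  obtain ⟨W, hWZ, hW, hpos⟩ := exists_finrank_eq_positiveIndex A Z
  obtain ⟨V, hVZ, hV, hneg⟩ := exists_finrank_eq_positiveIndex (-A) Z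
  have hdisj : Disjoint W V := by
    rw [Submodule.disjoint_def]
    intro x hxW hxV
    by_contra hne
    have h1 := hpos x hxW hne
    have h2 := hneg x hxV hne
    rw [neg_form_re] at h2
    linarith
  rw [← hW, ← hV, ← Submodule.finrank_sup_add_finrank_inf_eq, hdisj.eq_bot, finrank_bot, add_zero]
  exact Submodule.finrank_mono (sup_le hWZ hVZ)

theorem form_symm {A : Matrix ι ι ℂ} (hA : A.IsHermitian) (x y : ι → ℂ) :
    star y ⬝ᵥ (A *ᵥ x) = conj (star x ⬝ᵥ (A *ᵥ y)) := by
  rw [starRingEnd_apply, Matrix.star_dotProduct, Matrix.star_mulVec, hA.eq,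
    ← Matrix.dotProduct_mulVec]

/-- The linear functional `x ↦ eᴴ A x`. -/
noncomputable def formRight (A : Matrix ι ι ℂ) (e : ι → ℂ) : (ι → ℂ) →ₗ[ℂ] ℂ where
  toFun x := star e ⬝ᵥ (A *ᵥ x)
  map_add' x y := by rw [Matrix.mulVec_add, dotProduct_add]
  map_smul' c x := by rw [Matrix.mulVec_smul, dotProduct_smul]; rfl

theorem form_add_re {A : Matrix ι ι ℂ} (hA : A.IsHermitian) (x y : ι → ℂ) :
    (star (x + y) ⬝ᵥ (A *ᵥ (x + y))).re =
      (star x ⬝ᵥ (A *ᵥ x)).re + 2 * (star x ⬝ᵥ (A *ᵥ y)).re + (star y ⬝ᵥ (A *ᵥ y)).re := by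
  have h := congrArg Complex.re (form_symm hA x y)
  rw [Complex.conj_re] at h
  simp only [star_add, Matrix.mulVec_add, add_dotProduct, dotProduct_add, Complex.add_re, h]
  ring

theorem form_smul_re (A : Matrix ι ι ℂ) (c : ℂ) (x : ι → ℂ) :
    (star (c • x) ⬝ᵥ (A *ᵥ (c • x))).re = Complex.normSq c * (star x ⬝ᵥ (A *ᵥ x)).re := by
  have : star (c • x) ⬝ᵥ (A *ᵥ (c • x)) = (Complex.normSq c : ℂ) * (star x ⬝ᵥ (A *ᵥ x)) := by
    simp only [star_smul, Matrix.mulVec_smul, smul_dotProduct, dotProduct_smul, smul_eq_mul,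
      Complex.normSq_eq_conj_mul_self, Complex.star_def]
    ring
  rw [this, Complex.re_ofReal_mul]

/-- Adding to a positive definite subspace a vector orthogonal to it with positive value. -/
theorem finrank_add_one_le_positiveIndex {A : Matrix ι ι ℂ} (hA : A.IsHermitian)
    {Z W : Submodule ℂ (ι → ℂ)} (hW : W ≤ Z)
    (hpos : ∀ x ∈ W, x ≠ 0 → 0 < (star x ⬝ᵥ (A *ᵥ x)).re) {g : ι → ℂ} (hg : g ∈ Z)
    (hgpos : 0 < (star g ⬝ᵥ (A *ᵥ g)).re) (horth : ∀ w ∈ W, star w ⬝ᵥ (A *ᵥ g) = 0) :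
    Module.finrank ℂ W + 1 ≤ positiveIndex A Z := by
  have hgW : g ∉ W := fun h => by rw [horth g h] at hgpos; simp at hgpos
  have hg0 : g ≠ 0 := fun h => hgW (h ▸ W.zero_mem)
  have hdisj : W ⊓ Submodule.span ℂ {g} = ⊥ := by
    rw [← disjoint_iff, Submodule.disjoint_span_singleton' hg0]
    exact hgW
  have hdim := Submodule.finrank_sup_add_finrank_inf_eq W (Submodule.span ℂ {g})
  rw [hdisj, finrank_bot, finrank_span_singleton hg0, add_zero] at hdim
  rw [← hdim]
  refine le_positiveIndex (sup_le hW ?_) ?_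
  · rwa [Submodule.span_singleton_le_iff_mem]
  · intro x hx hx0
    obtain ⟨w, hw, y, hy, rfl⟩ := Submodule.mem_sup.1 hx
    obtain ⟨c, rfl⟩ := Submodule.mem_span_singleton.1 hy
    rw [form_add_re hA, form_smul_re, Matrix.mulVec_smul, dotProduct_smul, horth w hw]
    have h1 : 0 ≤ (star w ⬝ᵥ (A *ᵥ w)).re := by
      rcases eq_or_ne w 0 with rfl | h
      · simp
      · exact (hpos w hw h).le
    rcases eq_or_ne c 0 with rfl | hc
    · have := hpos w hw (by simpa using hx0)
      simpa using this
    · have := mul_pos (Complex.normSq_pos.2 hc) hgpos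
      simp only [smul_zero, Complex.zero_re]
      linarith

/-- The orthogonal complement of `e` within `Z`. -/
noncomputable def orthogonalWithin (A : Matrix ι ι ℂ) (Z : Submodule ℂ (ι → ℂ)) (e : ι → ℂ) :
    Submodule ℂ (ι → ℂ) :=
  Z ⊓ LinearMap.ker (formRight A e)

theorem mem_orthogonalWithin {A : Matrix ι ι ℂ} {Z : Submodule ℂ (ι → ℂ)} {e x : ι → ℂ} :
    x ∈ orthogonalWithin A Z e ↔ x ∈ Z ∧ star e ⬝ᵥ (A *ᵥ x) = 0 := Iff.rfl

/-- An isotropic vector `e` outside the radical spans, with a vector `f` not orthogonal to it, a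
hyperbolic plane, which contributes one positive direction that `e`'s complement lacks. -/
theorem positiveIndex_eq_orthogonalWithin_add_one {A : Matrix ι ι ℂ} (hA : A.IsHermitian)
    {Z : Submodule ℂ (ι → ℂ)} {e f : ι → ℂ} (he : e ∈ Z) (hf : f ∈ Z)
    (hee : star e ⬝ᵥ (A *ᵥ e) = 0) (hef : star e ⬝ᵥ (A *ᵥ f) ≠ 0) :
    positiveIndex A Z = positiveIndex A (orthogonalWithin A Z e) + 1 := by
  apply le_antisymm
  · obtain ⟨W, hWZ, hW, hpos⟩ := exists_finrank_eq_positiveIndex A Z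
    -- The functional `⟨e, ·⟩` cuts the dimension of `W` by at most one.
    let φ : W →ₗ[ℂ] ℂ := formRight A e ∘ₗ W.subtype
    have hk := le_positiveIndex (A := A) (Z := orthogonalWithin A Z e)
      (W := (LinearMap.ker φ).map W.subtype) (by
        rintro _ ⟨x, hx, rfl⟩
        exact ⟨hWZ x.2, hx⟩) (by
        rintro _ ⟨x, hx, rfl⟩ hne
        exact hpos _ x.2 hne)
    rw [Submodule.finrank_map_subtype_eq] at hk
    have h1 := φ.finrank_range_add_finrank_ker
    have h2 := (LinearMap.range φ).finrank_le
    rw [Module.finrank_self] at h2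
    omega
  · obtain ⟨W, hWZ, hW, hpos⟩ := exists_finrank_eq_positiveIndex A (orthogonalWithin A Z e)
    let b := Module.finBasis ℂ W
    have hfW : f ∉ W := fun h => hef (hWZ h).2
    have hf0 : f ≠ 0 := fun h => hfW (h ▸ W.zero_mem)
    have hdisj : W ⊓ Submodule.span ℂ {f} = ⊥ := by
      rw [← disjoint_iff, Submodule.disjoint_span_singleton' hf0]
      exact hfW
    have hdim := Submodule.finrank_sup_add_finrank_inf_eq W (Submodule.span ℂ {f})
    rw [hdisj, finrank_bot, finrank_span_singleton hf0, add_zero] at hdim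
    -- By dimension there is a vector `u` in `W + ℂ f` orthogonal to `W`.
    let φ : ↥(W ⊔ Submodule.span ℂ {f}) →ₗ[ℂ] (Fin (Module.finrank ℂ W) → ℂ) :=
      LinearMap.pi fun i => formRight A (b i : ι → ℂ) ∘ₗ
        (W ⊔ Submodule.span ℂ {f}).subtype
    have hker : LinearMap.ker φ ≠ ⊥ := LinearMap.ker_ne_bot_of_finrank_lt (by
      rw [hdim, Module.finrank_fin_fun]; omega)
    obtain ⟨⟨u, hu⟩, huk, hu0⟩ := Submodule.exists_mem_ne_zero_of_ne_bot hker
    have hbu : ∀ i, star (b i : ι → ℂ) ⬝ᵥ (A *ᵥ u) = 0 := fun i => congrFun huk i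
    have huW : ∀ w ∈ W, star w ⬝ᵥ (A *ᵥ u) = 0 := by
      intro w hw
      have := congrArg Subtype.val (b.sum_repr ⟨w, hw⟩)
      simp only [Submodule.coe_sum, Submodule.coe_smul] at this
      rw [← this, star_sum, sum_dotProduct]
      refine Finset.sum_eq_zero fun i _ => ?_
      rw [star_smul, smul_dotProduct, hbu, smul_zero]
    have huZ : u ∈ Z := (sup_le (hWZ.trans fun x hx => hx.1)
      ((Submodule.span_singleton_le_iff_mem f Z).2 hf)) hu
    have heu : star e ⬝ᵥ (A *ᵥ u) ≠ 0 := by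
      obtain ⟨w, hw, y, hy, rfl⟩ := Submodule.mem_sup.1 hu
      obtain ⟨c, rfl⟩ := Submodule.mem_span_singleton.1 hy
      rcases eq_or_ne c 0 with rfl | hc
      · exfalso
        have h1 := huW w hw
        rw [zero_smul, add_zero] at h1
        have h2 := hpos w hw (fun h => hu0 (by simp [h]))
        rw [h1] at h2
        simp at h2
      · rw [Matrix.mulVec_add, dotProduct_add, (mem_orthogonalWithin.1 (hWZ hw)).2, zero_add,
          Matrix.mulVec_smul, dotProduct_smul]
        exact smul_ne_zero hc hef
    -- A suitable multiple `t` of `e` makes the value at `u + t e` positive.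
    set z := star e ⬝ᵥ (A *ᵥ u) with hz
    set s : ℝ := (1 - (star u ⬝ᵥ (A *ᵥ u)).re) / 2
    have hgform : (star ((conj ((s : ℂ) / z)) • e + u) ⬝ᵥ
        (A *ᵥ ((conj ((s : ℂ) / z)) • e + u))).re = 1 := by
      rw [form_add_re hA, form_smul_re, hee, star_smul, smul_dotProduct, ← hz, ← starRingEnd_apply,
        Complex.conj_conj, smul_eq_mul, div_mul_cancel₀ _ heu, Complex.ofReal_re]
      simp only [Complex.zero_re, s]
      ring
    rw [← hW]
    refine finrank_add_one_le_positiveIndex hA (hWZ.trans fun x hx => hx.1) hpos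
      (g := (conj ((s : ℂ) / z)) • e + u) (Z.add_mem (Z.smul_mem _ he) huZ)
      (by rw [hgform]; exact one_pos) ?_
    intro w hw
    rw [Matrix.mulVec_add, dotProduct_add, huW w hw, Matrix.mulVec_smul, dotProduct_smul,
      form_symm hA, (mem_orthogonalWithin.1 (hWZ hw)).2]
    simp

/-- Passing to the orthogonal complement of an isotropic vector does not change the signature. -/
theorem hermitianSignature_orthogonalWithin {A : Matrix ι ι ℂ} (hA : A.IsHermitian)
    {Z : Submodule ℂ (ι → ℂ)} {e : ι → ℂ} (he : e ∈ Z) (hee : star e ⬝ᵥ (A *ᵥ e) = 0) :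
    hermitianSignature A (orthogonalWithin A Z e) = hermitianSignature A Z := by
  by_cases h : ∃ f ∈ Z, star e ⬝ᵥ (A *ᵥ f) ≠ 0
  · obtain ⟨f, hf, hef⟩ := h
    have h1 := positiveIndex_eq_orthogonalWithin_add_one hA he hf hee hef
    have h2 := positiveIndex_eq_orthogonalWithin_add_one hA.neg he hf
      (by rw [Matrix.neg_mulVec, dotProduct_neg, hee, neg_zero])
      (by rwa [Matrix.neg_mulVec, dotProduct_neg, neg_ne_zero])
    have h3 : orthogonalWithin (-A) Z e = orthogonalWithin A Z e := by
      ext x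
      simp [mem_orthogonalWithin, Matrix.neg_mulVec]
    rw [h3] at h2
    unfold hermitianSignature
    omega
  · push Not at h
    have h3 : orthogonalWithin A Z e = Z := le_antisymm (fun x hx => hx.1) fun x hx => ⟨hx, h x hx⟩
    rw [h3]

/-- An orthogonal family of vectors with positive values spans a positive definite subspace. -/
theorem card_le_positiveIndex_of_orthogonal {A : Matrix ι ι ℂ}
    {Z : Submodule ℂ (ι → ℂ)} {v : κ → ι → ℂ} (hv : ∀ s, v s ∈ Z)
    (horth : ∀ s t, s ≠ t → star (v s) ⬝ᵥ (A *ᵥ v t) = 0)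
    (hpos : ∀ s, 0 < (star (v s) ⬝ᵥ (A *ᵥ v s)).re) :
    Fintype.card κ ≤ positiveIndex A Z := by
  have key : ∀ c : κ → ℂ, (star (∑ s, c s • v s) ⬝ᵥ (A *ᵥ ∑ s, c s • v s)).re =
      ∑ s, Complex.normSq (c s) * (star (v s) ⬝ᵥ (A *ᵥ v s)).re := by
    intro c
    rw [star_sum, sum_dotProduct, Complex.re_sum]
    refine Finset.sum_congr rfl fun s _ => ?_
    rw [Matrix.mulVec_sum, dotProduct_sum, Finset.sum_eq_single s, form_smul_re]
    · intro t _ hts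
      rw [Matrix.mulVec_smul, dotProduct_smul, star_smul, smul_dotProduct, horth s t hts.symm]
      simp
    · simp
  have hzero : ∀ c : κ → ℂ, (star (∑ s, c s • v s) ⬝ᵥ (A *ᵥ ∑ s, c s • v s)).re ≤ 0 → c = 0 := by
    intro c hc
    rw [key] at hc
    have hnn : ∀ s ∈ Finset.univ, 0 ≤ Complex.normSq (c s) * (star (v s) ⬝ᵥ (A *ᵥ v s)).re :=
      fun s _ => mul_nonneg (Complex.normSq_nonneg _) (hpos s).le
    funext s
    have := (Finset.sum_eq_zero_iff_of_nonneg hnn).1 (hc.antisymm (Finset.sum_nonneg hnn)) s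
      (Finset.mem_univ s)
    simpa [(hpos s).ne'] using this
  have hli : LinearIndependent ℂ v := by
    rw [Fintype.linearIndependent_iff]
    intro c hc s
    rw [hzero c (by rw [hc]; simp)]
    rfl
  rw [← finrank_span_eq_card hli]
  refine le_positiveIndex (Submodule.span_le.2 (Set.range_subset_iff.2 hv)) ?_
  intro x hx hx0
  obtain ⟨c, rfl⟩ := (Submodule.mem_span_range_iff_exists_fun ℂ).1 hx
  by_contra hle
  rw [hzero c (not_lt.1 hle)] at hx0
  simp at hx0

end Inertia

/-! ### The Seifert pairing of a word -/

namespace ClosedBraid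

section Words

variable {r : ℕ}

/-- The linking coefficient of two bands in the positions `i` and `j`, the first of which comes
first. -/
noncomputable def coeffBefore (i j : Fin r) : ℂ :=
  if i = j then 1 / 2 else if (i : ℕ) = j + 1 then -1 else 0

/-- The linking coefficient of two bands in the positions `i` and `j`, the second of which comes
first. -/
noncomputable def coeffAfter (i j : Fin r) : ℂ :=
  if i = j then -(1 / 2) else 0

theorem linking_self (β : ClosedBraid) (k : Fin β.word.length) :
    (β.linking k k : ℂ) = -((β.sgn k : ℤ) / 2) := by
  simp [linking]

theorem linking_of_lt (β : ClosedBraid) {k l : Fin β.word.length} (h : k < l) :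
    (β.linking k l : ℂ) = coeffBefore (β.pos k) (β.pos l) := by
  simp only [linking, Matrix.of_apply, h, h.ne, coeffBefore, true_and, if_true, if_false]
  split_ifs <;> simp

theorem linking_of_gt (β : ClosedBraid) {k l : Fin β.word.length} (h : l < k) :
    (β.linking k l : ℂ) = coeffAfter (β.pos k) (β.pos l) := by
  simp only [linking, Matrix.of_apply, h.not_gt, h.ne', coeffAfter, false_and, if_false]
  split_ifs <;> simp

/-- The Seifert pairing `∑ k l, x k * linking k l * y l` of the closure of a word, extended
bilinearly to all vectors. -/
noncomputable def seifert (w : List (Fin r × ℤˣ)) (x y : Fin w.length → ℂ) : ℂ :=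
  ∑ k, ∑ l, x k * ((⟨r, w⟩ : ClosedBraid).linking k l : ℂ) * y l

/-- The total weight of a vector at each position: the sum over all bands of this position. -/
noncomputable def flux (w : List (Fin r × ℤˣ)) : (Fin w.length → ℂ) →ₗ[ℂ] (Fin r → ℂ) where
  toFun x i := ∑ k, if (w.get k).1 = i then x k else 0
  map_add' x y := by
    funext i
    simp only [Pi.add_apply, ← Finset.sum_add_distrib]
    exact Finset.sum_congr rfl fun k _ => by split_ifs <;> simp
  map_smul' c x := by
    funext i
    simp only [Pi.smul_apply, smul_eq_mul, Finset.mul_sum, RingHom.id_apply, mul_ite, mul_zero]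

theorem flux_apply (w : List (Fin r × ℤˣ)) (x : Fin w.length → ℂ) (i : Fin r) :
    flux w x i = ∑ k, if (w.get k).1 = i then x k else 0 := rfl

theorem flux_star (w : List (Fin r × ℤˣ)) (x : Fin w.length → ℂ) :
    flux w (star x) = star (flux w x) := by
  funext i
  simp only [flux_apply, Pi.star_apply, star_sum]
  exact Finset.sum_congr rfl fun k _ => by split_ifs <;> simp

theorem flux_nil (x : Fin ([] : List (Fin r × ℤˣ)).length → ℂ) : flux [] x = 0 := rfl

@[simp] theorem seifert_zero_left (w : List (Fin r × ℤˣ)) (y : Fin w.length → ℂ) :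
    seifert w 0 y = 0 := by
  simp [seifert]

@[simp] theorem seifert_zero_right (w : List (Fin r × ℤˣ)) (x : Fin w.length → ℂ) :
    seifert w x 0 = 0 := by
  simp [seifert]

theorem boundary_eq_sum_flux (w : List (Fin r × ℤˣ)) (x : Fin w.length → ℂ) :
    (⟨r, w⟩ : ClosedBraid).boundary x =
      ∑ i, flux w x i • (Pi.single i.succ (1 : ℂ) - Pi.single i.castSucc (1 : ℂ)) := by
  rw [boundary, Fintype.linearCombination_apply]
  simp only [flux_apply, Finset.sum_smul, ite_smul, zero_smul]
  rw [Finset.sum_comm]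
  refine Finset.sum_congr rfl fun k _ => ?_
  rw [Finset.sum_ite_eq]
  simp [pos]

/-- The cycles are the vectors whose total weight at each position is zero. -/
theorem mem_homology_iff (w : List (Fin r × ℤˣ)) (x : Fin w.length → ℂ) :
    x ∈ (⟨r, w⟩ : ClosedBraid).homology ↔ flux w x = 0 := by
  rw [homology, LinearMap.mem_ker, boundary_eq_sum_flux]
  constructor
  · intro h
    have hstep : ∀ (n : ℕ) (hn : n < r), flux w x ⟨n, hn⟩ = 0 := by
      intro n
      induction n with
      | zero =>
        intro hn
        have h0 := congrFun h (0 : Fin (r + 1))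
        rw [Finset.sum_apply, Finset.sum_eq_single ⟨0, hn⟩] at h0
        · have h1 : (⟨0, hn⟩ : Fin r).castSucc = 0 := rfl
          rw [Pi.smul_apply, Pi.sub_apply, h1] at h0
          simpa [Pi.single_apply, Fin.ext_iff] using h0
        · intro b _ hb
          have hb' : (b : ℕ) ≠ 0 := fun h => hb (Fin.ext h)
          simp [Fin.ext_iff, hb'.symm]
        · simp
      | succ n ih =>
        intro hn
        have hn' : n < r := by omega
        have h0 := congrFun h (⟨n + 1, by omega⟩ : Fin (r + 1))
        rw [Finset.sum_apply, Finset.sum_eq_add_of_mem ⟨n, hn'⟩ ⟨n + 1, hn⟩ (Finset.mem_univ _)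
          (Finset.mem_univ _) (by simp)] at h0
        · simpa [ih hn', Pi.single_apply, Fin.ext_iff] using h0
        · intro b _ hb
          have h1 : n ≠ (b : ℕ) := fun h => hb.1 (Fin.ext h.symm)
          have h2 : n + 1 ≠ (b : ℕ) := fun h => hb.2 (Fin.ext h.symm)
          simp [Fin.ext_iff, h1, h2]
    funext i
    exact hstep i i.2
  · intro h
    simp [h]

theorem form_hermitianMatrix (w : List (Fin r × ℤˣ)) (ω : ℂ) (x y : Fin w.length → ℂ) :
    star x ⬝ᵥ ((⟨r, w⟩ : ClosedBraid).hermitianMatrix ω *ᵥ y) =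
      (1 - ω) * seifert w (star x) y + (1 - conj ω) * seifert w y (star x) := by
  simp only [hermitianMatrix, Matrix.add_mulVec, Matrix.smul_mulVec, dotProduct_add,
    dotProduct_smul, smul_eq_mul, seifert]
  congr 2
  · simp only [dotProduct, Matrix.mulVec, Finset.mul_sum, Matrix.map_apply, mul_assoc]
  · rw [Finset.sum_comm]
    simp only [dotProduct, Matrix.mulVec, Finset.mul_sum, Matrix.map_apply, Matrix.transpose_apply]
    exact Finset.sum_congr rfl fun k _ => Finset.sum_congr rfl fun l _ => by ring

/-- Real linear maps in both directions that preserve cycles and the Seifert pairing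
preserve the signatures of the Hermitian forms. -/
theorem hermitianSignature_eq_of_seifert {r' : ℕ} {w : List (Fin r × ℤˣ)}
    {w' : List (Fin r' × ℤˣ)} (ω : ℂ) {Z : Submodule ℂ (Fin w.length → ℂ)}
    {Y : Submodule ℂ (Fin w'.length → ℂ)}
    (hZ : ∀ x ∈ Z, star x ∈ Z) (hY : ∀ y ∈ Y, star y ∈ Y)
    (T : (Fin w.length → ℂ) →ₗ[ℂ] (Fin w'.length → ℂ))
    (U : (Fin w'.length → ℂ) →ₗ[ℂ] (Fin w.length → ℂ))
    (hTs : ∀ x, T (star x) = star (T x)) (hUs : ∀ y, U (star y) = star (U y))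
    (hT : ∀ x ∈ Z, T x ∈ Y) (hU : ∀ y ∈ Y, U y ∈ Z)
    (hTS : ∀ x ∈ Z, ∀ y ∈ Z, seifert w' (T x) (T y) = seifert w x y)
    (hUS : ∀ x ∈ Y, ∀ y ∈ Y, seifert w (U x) (U y) = seifert w' x y) :
    hermitianSignature ((⟨r, w⟩ : ClosedBraid).hermitianMatrix ω) Z =
      hermitianSignature ((⟨r', w'⟩ : ClosedBraid).hermitianMatrix ω) Y := by
  refine hermitianSignature_eq_of_maps T U hT hU ?_ ?_
  · intro x hx
    rw [form_hermitianMatrix, form_hermitianMatrix, ← hTs, hTS _ (hZ x hx) _ hx,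
      hTS _ hx _ (hZ x hx)]
  · intro y hy
    rw [form_hermitianMatrix, form_hermitianMatrix, ← hUs, hUS _ (hY y hy) _ hy,
      hUS _ hy _ (hY y hy)]

theorem star_mem_homology (w : List (Fin r × ℤˣ)) (x : Fin w.length → ℂ)
    (hx : x ∈ (⟨r, w⟩ : ClosedBraid).homology) : star x ∈ (⟨r, w⟩ : ClosedBraid).homology := by
  rw [mem_homology_iff] at hx ⊢
  rw [flux_star, hx, star_zero]

/-! ### Concatenation of words -/

/-- The restriction of a vector to the bands of the first of two words. -/
noncomputable def left (u v : List (Fin r × ℤˣ)) :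
    (Fin (u ++ v).length → ℂ) →ₗ[ℂ] (Fin u.length → ℂ) :=
  LinearMap.funLeft ℂ ℂ fun k => Fin.cast List.length_append.symm (Fin.castAdd v.length k)

/-- The restriction of a vector to the bands of the second of two words. -/
noncomputable def right (u v : List (Fin r × ℤˣ)) :
    (Fin (u ++ v).length → ℂ) →ₗ[ℂ] (Fin v.length → ℂ) :=
  LinearMap.funLeft ℂ ℂ fun k => Fin.cast List.length_append.symm (Fin.natAdd u.length k)

/-- The vector with given restrictions to the bands of two concatenated words. -/
noncomputable def join (u v : List (Fin r × ℤˣ)) (x : Fin u.length → ℂ) (y : Fin v.length → ℂ) :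
    Fin (u ++ v).length → ℂ :=
  fun k => Fin.append x y (Fin.cast List.length_append k)

variable (u v : List (Fin r × ℤˣ))

theorem left_apply (x : Fin (u ++ v).length → ℂ) (k : Fin u.length) :
    left u v x k = x (Fin.cast List.length_append.symm (Fin.castAdd v.length k)) := rfl

theorem right_apply (x : Fin (u ++ v).length → ℂ) (k : Fin v.length) :
    right u v x k = x (Fin.cast List.length_append.symm (Fin.natAdd u.length k)) := rfl

@[simp] theorem left_join (x : Fin u.length → ℂ) (y : Fin v.length → ℂ) :
    left u v (join u v x y) = x := by
  funext k
  simp [left_apply, join]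

@[simp] theorem right_join (x : Fin u.length → ℂ) (y : Fin v.length → ℂ) :
    right u v (join u v x y) = y := by
  funext k
  simp [right_apply, join]

theorem left_star (x : Fin (u ++ v).length → ℂ) : left u v (star x) = star (left u v x) := rfl

theorem right_star (x : Fin (u ++ v).length → ℂ) : right u v (star x) = star (right u v x) := rfl

theorem sum_fin_append {M : Type*} [AddCommMonoid M] (F : Fin (u ++ v).length → M) :
    ∑ k, F k = (∑ k, F (Fin.cast List.length_append.symm (Fin.castAdd v.length k))) +
      ∑ k, F (Fin.cast List.length_append.symm (Fin.natAdd u.length k)) := by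
  rw [← Fin.sum_univ_add fun k => F (Fin.cast List.length_append.symm k)]
  exact (Fintype.sum_equiv (finCongr List.length_append) _ _ fun k => rfl)

theorem join_ext {x y : Fin (u ++ v).length → ℂ} (h1 : left u v x = left u v y)
    (h2 : right u v x = right u v y) : x = y := by
  have hall : ∀ k, x (Fin.cast List.length_append.symm k) =
      y (Fin.cast List.length_append.symm k) := fun k =>
    Fin.addCases (fun k => congrFun h1 k) (fun k => congrFun h2 k) k
  funext k
  exact hall (Fin.cast List.length_append k)

theorem join_star (x : Fin u.length → ℂ) (y : Fin v.length → ℂ) :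
    join u v (star x) (star y) = star (join u v x y) := by
  apply join_ext <;> simp [left_star, right_star]

theorem get_append_left (k : Fin u.length) :
    (u ++ v).get (Fin.cast List.length_append.symm (Fin.castAdd v.length k)) = u.get k := by
  simp

theorem get_append_right (k : Fin v.length) :
    (u ++ v).get (Fin.cast List.length_append.symm (Fin.natAdd u.length k)) = v.get k := by
  simp

theorem flux_append (x : Fin (u ++ v).length → ℂ) :
    flux (u ++ v) x = flux u (left u v x) + flux v (right u v x) := by
  funext i
  simp only [flux_apply, Pi.add_apply]
  rw [sum_fin_append]
  simp only [get_append_left, get_append_right]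
  rfl

/-- The part of the Seifert pairing between an earlier and a later word, which depends only on the
total weights `a` and `b` of the two vectors. -/
noncomputable def crossing (a b : Fin r → ℂ) : ℂ :=
  ∑ i, ∑ j, coeffBefore i j * (a i * b j)

theorem crossing_neg_left (a b : Fin r → ℂ) : crossing (-a) b = -crossing a b := by
  simp [crossing]

@[simp] theorem crossing_zero_left (b : Fin r → ℂ) : crossing 0 b = 0 := by
  simp [crossing]

@[simp] theorem crossing_zero_right (a : Fin r → ℂ) : crossing a 0 = 0 := by
  simp [crossing]

theorem crossing_neg_right (a b : Fin r → ℂ) : crossing a (-b) = -crossing a b := by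
  simp [crossing]

theorem sum_sum_flux (c : Fin r → Fin r → ℂ) (x : Fin u.length → ℂ) (y : Fin v.length → ℂ) :
    ∑ k, ∑ l, c (u.get k).1 (v.get l).1 * (x k * y l) =
      ∑ i, ∑ j, c i j * (flux u x i * flux v y j) := by
  simp only [flux_apply, Finset.sum_mul_sum]
  simp only [Finset.mul_sum]
  calc _ = ∑ k, ∑ l, ∑ i, ∑ j, c i j *
        ((if (u.get k).1 = i then x k else 0) * (if (v.get l).1 = j then y l else 0)) := by
        refine Finset.sum_congr rfl fun k _ => Finset.sum_congr rfl fun l _ => ?_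
        rw [Finset.sum_eq_single (u.get k).1, Finset.sum_eq_single (v.get l).1]
        · simp
        · intro j _ hj
          rw [if_neg hj.symm]; ring
        · simp
        · intro i _ hi
          refine Finset.sum_eq_zero fun j _ => ?_
          rw [if_neg hi.symm]; ring
        · simp
    _ = ∑ k, ∑ i, ∑ l, ∑ j, _ := Finset.sum_congr rfl fun k _ => Finset.sum_comm
    _ = ∑ i, ∑ k, ∑ l, ∑ j, _ := Finset.sum_comm
    _ = ∑ i, ∑ k, ∑ j, ∑ l, _ :=
        Finset.sum_congr rfl fun i _ => Finset.sum_congr rfl fun k _ => Finset.sum_comm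
    _ = _ := Finset.sum_congr rfl fun i _ => Finset.sum_comm

theorem seifert_append (x y : Fin (u ++ v).length → ℂ) :
    seifert (u ++ v) x y = seifert u (left u v x) (left u v y) +
      seifert v (right u v x) (right u v y) +
      crossing (flux u (left u v x)) (flux v (right u v y)) -
      (flux v (right u v x) ⬝ᵥ flux u (left u v y)) / 2 := by
  have h1 : crossing (flux u (left u v x)) (flux v (right u v y)) = ∑ k, ∑ l,
      coeffBefore (u.get k).1 (v.get l).1 *
        (left u v x k * right u v y l) :=
    (sum_sum_flux u v coeffBefore _ _).symm
  have h2 : -((flux v (right u v x) ⬝ᵥ flux u (left u v y)) / 2) = ∑ k, ∑ l,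
      coeffAfter (v.get k).1 (u.get l).1 * (right u v x k * left u v y l) := by
    rw [sum_sum_flux v u coeffAfter]
    simp only [coeffAfter, ite_mul, zero_mul, Finset.sum_ite_eq, Finset.mem_univ, if_true,
      dotProduct, Finset.sum_div, ← Finset.sum_neg_distrib]
    exact Finset.sum_congr rfl fun i _ => by ring
  rw [sub_eq_add_neg, h1, h2]
  simp only [seifert, left_apply, right_apply]
  rw [sum_fin_append]
  simp only [sum_fin_append u v (fun l => _ * _ * y l), Finset.sum_add_distrib]
  have hL : ∀ k l, (⟨r, u ++ v⟩ : ClosedBraid).linking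
      (Fin.cast List.length_append.symm (Fin.castAdd v.length k))
      (Fin.cast List.length_append.symm (Fin.castAdd v.length l)) =
      (⟨r, u⟩ : ClosedBraid).linking k l := by
    intro k l
    simp only [linking, pos, sgn, Matrix.of_apply, get_append_left, Fin.ext_iff, Fin.lt_def,
      Fin.val_cast, Fin.val_castAdd]
  have hR : ∀ k l, (⟨r, u ++ v⟩ : ClosedBraid).linking
      (Fin.cast List.length_append.symm (Fin.natAdd u.length k))
      (Fin.cast List.length_append.symm (Fin.natAdd u.length l)) =
      (⟨r, v⟩ : ClosedBraid).linking k l := by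
    intro k l
    simp only [linking, pos, sgn, Matrix.of_apply, get_append_right, Fin.ext_iff, Fin.lt_def,
      Fin.val_cast, Fin.val_natAdd, Nat.add_left_cancel_iff, Nat.add_lt_add_iff_left]
  have hLR : ∀ k l, (((⟨r, u ++ v⟩ : ClosedBraid).linking
      (Fin.cast List.length_append.symm (Fin.castAdd v.length k))
      (Fin.cast List.length_append.symm (Fin.natAdd u.length l)) : ℚ) : ℂ) =
      coeffBefore (u.get k).1 (v.get l).1 := by
    intro k l
    rw [linking_of_lt _ (by
      simp only [Fin.lt_def, Fin.val_cast, Fin.val_castAdd, Fin.val_natAdd]; omega)]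
    simp only [pos, get_append_left, get_append_right]
  have hRL : ∀ k l, (((⟨r, u ++ v⟩ : ClosedBraid).linking
      (Fin.cast List.length_append.symm (Fin.natAdd u.length k))
      (Fin.cast List.length_append.symm (Fin.castAdd v.length l)) : ℚ) : ℂ) =
      coeffAfter (v.get k).1 (u.get l).1 := by
    intro k l
    rw [linking_of_gt _ (by
      simp only [Fin.lt_def, Fin.val_cast, Fin.val_castAdd, Fin.val_natAdd]; omega)]
    simp only [pos, get_append_left, get_append_right]
  simp only [hL, hR, hLR, hRL]
  have e1 : ∀ a b c d a' d' : ℂ, a = a' → d = d' → a + b + (c + d) = a' + d' + b + c := by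
    intro a b c d a' d' h h'; rw [h, h']; ring
  refine (e1 _ _ _ _ _ _ rfl rfl).trans ?_
  congr 1
  · congr 1
    exact Finset.sum_congr rfl fun k _ => Finset.sum_congr rfl fun l _ => by ring
  · exact Finset.sum_congr rfl fun k _ => Finset.sum_congr rfl fun l _ => by ring

end Words

end ClosedBraid

namespace ClosedBraid

section Invariance

variable {r : ℕ}

/-- The signature at `ω` of the Seifert form of a closed braid. -/
noncomputable def signatureAt (ω : ℂ) (β : ClosedBraid) : ℤ :=
  hermitianSignature (β.hermitianMatrix ω) β.homology

/-! ### Local changes of a word -/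

/-- The map on vectors that applies `T` to the bands of the middle one of three words and leaves
the other coordinates as they are. -/
noncomputable def replaceMiddle (u v : List (Fin r × ℤˣ)) {s s' : List (Fin r × ℤˣ)}
    (T : (Fin s.length → ℂ) →ₗ[ℂ] (Fin s'.length → ℂ)) :
    (Fin (u ++ s ++ v).length → ℂ) →ₗ[ℂ] (Fin (u ++ s' ++ v).length → ℂ) where
  toFun x := join (u ++ s') v (join u s' (left u s (left (u ++ s) v x))
    (T (right u s (left (u ++ s) v x)))) (right (u ++ s) v x)
  map_add' x y := by
    apply join_ext
    · apply join_ext <;> simp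
    · simp
  map_smul' c x := by
    apply join_ext
    · apply join_ext <;> simp
    · simp

section

variable (u v : List (Fin r × ℤˣ)) {s s' : List (Fin r × ℤˣ)}
  (T : (Fin s.length → ℂ) →ₗ[ℂ] (Fin s'.length → ℂ))

theorem left_replaceMiddle (x : Fin (u ++ s ++ v).length → ℂ) :
    left (u ++ s') v (replaceMiddle u v T x) = join u s' (left u s (left (u ++ s) v x))
      (T (right u s (left (u ++ s) v x))) :=
  left_join _ _ _ _

theorem right_replaceMiddle (x : Fin (u ++ s ++ v).length → ℂ) :
    right (u ++ s') v (replaceMiddle u v T x) = right (u ++ s) v x :=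
  right_join _ _ _ _

theorem replaceMiddle_star (hT : ∀ a, T (star a) = star (T a))
    (x : Fin (u ++ s ++ v).length → ℂ) :
    replaceMiddle u v T (star x) = star (replaceMiddle u v T x) := by
  apply join_ext
  · apply join_ext
    · simp [left_star, left_replaceMiddle]
    · simp [left_star, right_star, left_replaceMiddle, hT]
  · simp [right_star, right_replaceMiddle]

theorem flux_replaceMiddle (x : Fin (u ++ s ++ v).length → ℂ)
    (hx : flux s' (T (right u s (left (u ++ s) v x))) = flux s (right u s (left (u ++ s) v x))) :
    flux (u ++ s' ++ v) (replaceMiddle u v T x) = flux (u ++ s ++ v) x := by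
  simp only [flux_append, left_replaceMiddle, right_replaceMiddle, left_join, right_join, hx]

theorem seifert_replaceMiddle (x y : Fin (u ++ s ++ v).length → ℂ)
    (hx : flux s' (T (right u s (left (u ++ s) v x))) = flux s (right u s (left (u ++ s) v x)))
    (hy : flux s' (T (right u s (left (u ++ s) v y))) = flux s (right u s (left (u ++ s) v y)))
    (hxy : seifert s' (T (right u s (left (u ++ s) v x))) (T (right u s (left (u ++ s) v y))) =
      seifert s (right u s (left (u ++ s) v x)) (right u s (left (u ++ s) v y))) :
    seifert (u ++ s' ++ v) (replaceMiddle u v T x) (replaceMiddle u v T y) =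
      seifert (u ++ s ++ v) x y := by
  simp only [seifert_append, flux_append, left_replaceMiddle, right_replaceMiddle, left_join,
    right_join, hx, hy, hxy]

/-- A change of a subword does not affect the signature if the vectors on the two subwords
correspond under maps that preserve the total weights and the Seifert pairing. -/
theorem signatureAt_replace (ω : ℂ) (U : (Fin s'.length → ℂ) →ₗ[ℂ] (Fin s.length → ℂ))
    (hTs : ∀ a, T (star a) = star (T a)) (hUs : ∀ a, U (star a) = star (U a))
    (hTf : ∀ a, flux s' (T a) = flux s a) (hUf : ∀ a, flux s (U a) = flux s' a)
    (hTS : ∀ a b, seifert s' (T a) (T b) = seifert s a b)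
    (hUS : ∀ a b, seifert s (U a) (U b) = seifert s' a b) :
    signatureAt ω ⟨r, u ++ s ++ v⟩ = signatureAt ω ⟨r, u ++ s' ++ v⟩ := by
  refine hermitianSignature_eq_of_seifert ω (star_mem_homology _) (star_mem_homology _)
    (replaceMiddle u v T) (replaceMiddle u v U) (replaceMiddle_star u v T hTs)
    (replaceMiddle_star u v U hUs) ?_ ?_ ?_ ?_
  · intro x hx
    rw [mem_homology_iff] at hx ⊢
    rw [flux_replaceMiddle u v T x (hTf _), hx]
  · intro x hx
    rw [mem_homology_iff] at hx ⊢
    rw [flux_replaceMiddle u v U x (hUf _), hx]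
  · exact fun x _ y _ => seifert_replaceMiddle u v T x y (hTf _) (hTf _) (hTS _ _)
  · exact fun x _ y _ => seifert_replaceMiddle u v U x y (hUf _) (hUf _) (hUS _ _)

end

theorem flux_singleton (a : Fin r × ℤˣ) (x : Fin 1 → ℂ) :
    flux [a] x = Pi.single a.1 (x 0) := by
  funext i
  refine (Fin.sum_univ_one (fun k : Fin 1 => if ([a].get k).1 = i then x k else 0)).trans ?_
  simp [Pi.single_apply, eq_comm]

theorem flux_pair (a b : Fin r × ℤˣ) (x : Fin 2 → ℂ) :
    flux [a, b] x = Pi.single a.1 (x 0) + Pi.single b.1 (x 1) := by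
  funext i
  refine (Fin.sum_univ_two (fun k : Fin 2 => if ([a, b].get k).1 = i then x k else 0)).trans ?_
  simp [Pi.single_apply, eq_comm]

theorem flux_triple (a b c : Fin r × ℤˣ) (x : Fin 3 → ℂ) :
    flux [a, b, c] x = Pi.single a.1 (x 0) + Pi.single b.1 (x 1) + Pi.single c.1 (x 2) := by
  funext i
  refine (Fin.sum_univ_three
    (fun k : Fin 3 => if ([a, b, c].get k).1 = i then x k else 0)).trans ?_
  simp [Pi.single_apply, eq_comm]

theorem seifert_pair (a b : Fin r × ℤˣ) (x y : Fin 2 → ℂ) :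
    seifert [a, b] x y = x 0 * -((a.2 : ℤ) / 2) * y 0 + x 0 * coeffBefore a.1 b.1 * y 1 +
      (x 1 * coeffAfter b.1 a.1 * y 0 + x 1 * -((b.2 : ℤ) / 2) * y 1) := by
  have h : ∀ F : Fin 2 → Fin 2 → ℂ, ∑ k, ∑ l, F k l = F 0 0 + F 0 1 + (F 1 0 + F 1 1) := by
    intro F
    simp only [Fin.sum_univ_two]
  let β : ClosedBraid := ⟨r, [a, b]⟩
  have h00 : (β.linking (0 : Fin 2) (0 : Fin 2) : ℂ) = _ := linking_self β _
  have h11 : (β.linking (1 : Fin 2) (1 : Fin 2) : ℂ) = _ := linking_self β _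
  have h01 : (β.linking (0 : Fin 2) (1 : Fin 2) : ℂ) = _ :=
    linking_of_lt β (show (0 : Fin 2) < 1 by decide)
  have h10 : (β.linking (1 : Fin 2) (0 : Fin 2) : ℂ) = _ :=
    linking_of_gt β (show (0 : Fin 2) < 1 by decide)
  refine (h fun k l => x k * (β.linking k l : ℂ) * y l).trans ?_
  rw [h00, h01, h10, h11]
  rfl

theorem seifert_triple (a b c : Fin r × ℤˣ) (x y : Fin 3 → ℂ) :
    seifert [a, b, c] x y =
      x 0 * -((a.2 : ℤ) / 2) * y 0 + x 0 * coeffBefore a.1 b.1 * y 1 +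
        x 0 * coeffBefore a.1 c.1 * y 2 +
      (x 1 * coeffAfter b.1 a.1 * y 0 + x 1 * -((b.2 : ℤ) / 2) * y 1 +
        x 1 * coeffBefore b.1 c.1 * y 2) +
      (x 2 * coeffAfter c.1 a.1 * y 0 + x 2 * coeffAfter c.1 b.1 * y 1 +
        x 2 * -((c.2 : ℤ) / 2) * y 2) := by
  have h : ∀ F : Fin 3 → Fin 3 → ℂ, ∑ k, ∑ l, F k l = F 0 0 + F 0 1 + F 0 2 +
      (F 1 0 + F 1 1 + F 1 2) + (F 2 0 + F 2 1 + F 2 2) := by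
    intro F
    simp only [Fin.sum_univ_three]
  let β : ClosedBraid := ⟨r, [a, b, c]⟩
  have h00 : (β.linking (0 : Fin 3) (0 : Fin 3) : ℂ) = _ := linking_self β _
  have h11 : (β.linking (1 : Fin 3) (1 : Fin 3) : ℂ) = _ := linking_self β _
  have h22 : (β.linking (2 : Fin 3) (2 : Fin 3) : ℂ) = _ := linking_self β _
  have h01 : (β.linking (0 : Fin 3) (1 : Fin 3) : ℂ) = _ :=
    linking_of_lt β (show (0 : Fin 3) < 1 by decide)
  have h02 : (β.linking (0 : Fin 3) (2 : Fin 3) : ℂ) = _ :=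
    linking_of_lt β (show (0 : Fin 3) < 2 by decide)
  have h12 : (β.linking (1 : Fin 3) (2 : Fin 3) : ℂ) = _ :=
    linking_of_lt β (show (1 : Fin 3) < 2 by decide)
  have h10 : (β.linking (1 : Fin 3) (0 : Fin 3) : ℂ) = _ :=
    linking_of_gt β (show (0 : Fin 3) < 1 by decide)
  have h20 : (β.linking (2 : Fin 3) (0 : Fin 3) : ℂ) = _ :=
    linking_of_gt β (show (0 : Fin 3) < 2 by decide)
  have h21 : (β.linking (2 : Fin 3) (1 : Fin 3) : ℂ) = _ :=
    linking_of_gt β (show (1 : Fin 3) < 2 by decide)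
  refine (h fun k l => x k * (β.linking k l : ℂ) * y l).trans ?_
  rw [h00, h01, h02, h10, h11, h12, h20, h21, h22]
  rfl

theorem signatureAt_comm (ω : ℂ) (u v : List (Fin r × ℤˣ)) (i j : Fin r) (ε δ : ℤˣ)
    (hij : (i : ℕ) + 1 < j) :
    signatureAt ω ⟨r, u ++ [(i, ε), (j, δ)] ++ v⟩ =
      signatureAt ω ⟨r, u ++ [(j, δ), (i, ε)] ++ v⟩ := by
  let T : (Fin 2 → ℂ) →ₗ[ℂ] (Fin 2 → ℂ) := LinearMap.funLeft ℂ ℂ ![1, 0]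
  have T0 : ∀ a, T a 0 = a 1 := fun _ => rfl
  have T1 : ∀ a, T a 1 = a 0 := fun _ => rfl
  have hne : i ≠ j := fun h => by subst h; omega
  have hne1 : (j : ℕ) ≠ i + 1 := by omega
  have hne2 : (i : ℕ) ≠ j + 1 := by omega
  refine signatureAt_replace u v (s := [(i, ε), (j, δ)]) (s' := [(j, δ), (i, ε)]) T ω T
    (fun _ => rfl) (fun _ => rfl) ?_ ?_ ?_ ?_
  · intro a
    rw [flux_pair, flux_pair, T0, T1, add_comm]
  · intro a
    rw [flux_pair, flux_pair, T0, T1, add_comm]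
  · intro a b
    rw [seifert_pair, seifert_pair, T0, T1, T0, T1]
    simp only [coeffBefore, coeffAfter, hne, hne.symm, hne1, hne2, if_false]
    ring
  · intro a b
    rw [seifert_pair, seifert_pair, T0, T1, T0, T1]
    simp only [coeffBefore, coeffAfter, hne, hne.symm, hne1, hne2, if_false]
    ring

/-- In the braid relation, the vectors `(x₀, x₁, x₂)` on one side correspond to the vectors
`(x₁ - x₀, x₀ + x₂, x₀)` on the other. -/
theorem signatureAt_braid (ω : ℂ) (u v : List (Fin r × ℤˣ)) (i j : Fin r)
    (hij : (i : ℕ) + 1 = j) :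
    signatureAt ω ⟨r, u ++ [(i, 1), (j, 1), (i, 1)] ++ v⟩ =
      signatureAt ω ⟨r, u ++ [(j, 1), (i, 1), (j, 1)] ++ v⟩ := by
  let T : (Fin 3 → ℂ) →ₗ[ℂ] (Fin 3 → ℂ) :=
    Matrix.mulVecLin !![-1, 1, 0; 1, 0, 1; 1, 0, 0]
  let U : (Fin 3 → ℂ) →ₗ[ℂ] (Fin 3 → ℂ) :=
    Matrix.mulVecLin !![0, 0, 1; 1, 0, 1; 0, 1, -1]
  have T0 : ∀ a, T a 0 = a 1 - a 0 := fun a => by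
    simp [T, Matrix.mulVec, dotProduct, Fin.sum_univ_three]; ring
  have T1 : ∀ a, T a 1 = a 0 + a 2 := fun a => by
    simp [T, Matrix.mulVec, dotProduct, Fin.sum_univ_three]
  have T2 : ∀ a, T a 2 = a 0 := fun a => by
    simp [T, Matrix.mulVec, dotProduct, Fin.sum_univ_three]
  have U0 : ∀ a, U a 0 = a 2 := fun a => by
    simp [U, Matrix.mulVec, dotProduct, Fin.sum_univ_three]
  have U1 : ∀ a, U a 1 = a 0 + a 2 := fun a => by
    simp [U, Matrix.mulVec, dotProduct, Fin.sum_univ_three]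
  have U2 : ∀ a, U a 2 = a 1 - a 2 := fun a => by
    simp [U, Matrix.mulVec, dotProduct, Fin.sum_univ_three]; ring
  have hne : i ≠ j := fun h => by subst h; omega
  have hne2 : (i : ℕ) ≠ i + 1 + 1 := by omega
  refine signatureAt_replace u v (s := [(i, 1), (j, 1), (i, 1)]) (s' := [(j, 1), (i, 1), (j, 1)])
    T ω U ?_ ?_ ?_ ?_ ?_ ?_
  · intro a
    funext k
    fin_cases k
    · exact (T0 _).trans (by simp [T0])
    · exact (T1 _).trans (by simp [T1])
    · exact (T2 _).trans (by simp [T2])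
  · intro a
    funext k
    fin_cases k
    · exact (U0 _).trans (by simp [U0])
    · exact (U1 _).trans (by simp [U1])
    · exact (U2 _).trans (by simp [U2])
  · intro a
    rw [flux_triple, flux_triple, T0, T1, T2, Pi.single_sub, Pi.single_add]
    abel
  · intro a
    rw [flux_triple, flux_triple, U0, U1, U2, Pi.single_sub, Pi.single_add]
    abel
  · intro a b
    rw [seifert_triple, seifert_triple]
    simp only [coeffBefore, coeffAfter, hne, hne.symm, hne2, hij.symm, T0, T1, T2, if_true,
      if_false, Units.val_one, Int.cast_one]
    ring
  · intro a b
    rw [seifert_triple, seifert_triple]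
    simp only [coeffBefore, coeffAfter, hne, hne.symm, hne2, hij.symm, U0, U1, U2, if_true,
      if_false, Units.val_one, Int.cast_one]
    ring

/-! ### Cyclic permutation -/

/-- The map on vectors that moves the bands of the first of two words behind those of the second
one. -/
noncomputable def rotate (u v : List (Fin r × ℤˣ)) :
    (Fin (u ++ v).length → ℂ) →ₗ[ℂ] (Fin (v ++ u).length → ℂ) where
  toFun x := join v u (right u v x) (left u v x)
  map_add' x y := by apply join_ext <;> simp
  map_smul' c x := by apply join_ext <;> simp

theorem rotate_star (u v : List (Fin r × ℤˣ)) (x : Fin (u ++ v).length → ℂ) :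
    rotate u v (star x) = star (rotate u v x) :=
  join_star v u (right u v x) (left u v x)

theorem left_rotate (u v : List (Fin r × ℤˣ)) (x : Fin (u ++ v).length → ℂ) :
    left v u (rotate u v x) = right u v x := left_join _ _ _ _

theorem right_rotate (u v : List (Fin r × ℤˣ)) (x : Fin (u ++ v).length → ℂ) :
    right v u (rotate u v x) = left u v x := right_join _ _ _ _

theorem flux_rotate (u v : List (Fin r × ℤˣ)) (x : Fin (u ++ v).length → ℂ) :
    flux (v ++ u) (rotate u v x) = flux (u ++ v) x := by
  rw [flux_append, flux_append, left_rotate, right_rotate, add_comm]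

theorem seifert_rotate (u v : List (Fin r × ℤˣ)) {x y : Fin (u ++ v).length → ℂ}
    (hx : flux (u ++ v) x = 0) (hy : flux (u ++ v) y = 0) :
    seifert (v ++ u) (rotate u v x) (rotate u v y) = seifert (u ++ v) x y := by
  rw [flux_append] at hx hy
  rw [seifert_append, seifert_append, left_rotate, right_rotate, left_rotate, right_rotate,
    eq_neg_of_add_eq_zero_right hx, eq_neg_of_add_eq_zero_right hy, crossing_neg_left,
    crossing_neg_right, neg_dotProduct, dotProduct_neg]
  ring

theorem signatureAt_append_comm (ω : ℂ) (u v : List (Fin r × ℤˣ)) :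
    signatureAt ω ⟨r, u ++ v⟩ = signatureAt ω ⟨r, v ++ u⟩ := by
  have hmem : ∀ u v : List (Fin r × ℤˣ), ∀ x ∈ (⟨r, u ++ v⟩ : ClosedBraid).homology,
      rotate u v x ∈ (⟨r, v ++ u⟩ : ClosedBraid).homology := by
    intro u v x hx
    rw [mem_homology_iff] at hx ⊢
    rw [flux_rotate, hx]
  refine hermitianSignature_eq_of_seifert ω (star_mem_homology _) (star_mem_homology _)
    (rotate u v) (rotate v u) (rotate_star u v) (rotate_star v u) (hmem u v) (hmem v u) ?_ ?_
  · intro x hx y hy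
    exact seifert_rotate u v ((mem_homology_iff _ _).1 hx) ((mem_homology_iff _ _).1 hy)
  · intro x hx y hy
    exact seifert_rotate v u ((mem_homology_iff _ _).1 hx) ((mem_homology_iff _ _).1 hy)

/-! ### Stabilization -/

/-- The letter of a braid on one more strand that corresponds to a given letter. -/
def liftLetter (a : Fin r × ℤˣ) : Fin (r + 1) × ℤˣ := (a.1.castSucc, a.2)

/-- The bands of a word and of the same word on one more strand correspond. -/
def liftIndex (u : List (Fin r × ℤˣ)) : Fin u.length ≃ Fin (u.map liftLetter).length :=
  finCongr (List.length_map liftLetter).symm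

theorem val_liftIndex (u : List (Fin r × ℤˣ)) (k : Fin u.length) : (liftIndex u k : ℕ) = k := rfl

theorem get_map_liftLetter (u : List (Fin r × ℤˣ)) (k : Fin u.length) :
    (u.map liftLetter).get (liftIndex u k) = liftLetter (u.get k) := by
  simp [liftIndex]

/-- The coordinates of a vector on the bands of a word, regarded as a word with one more
strand. -/
noncomputable def restrictLift (u : List (Fin r × ℤˣ)) :
    (Fin (u.map liftLetter).length → ℂ) ≃ₗ[ℂ] (Fin u.length → ℂ) :=
  LinearEquiv.funCongrLeft ℂ ℂ (liftIndex u)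

theorem sum_fin_map {M : Type*} [AddCommMonoid M] (u : List (Fin r × ℤˣ))
    (F : Fin (u.map liftLetter).length → M) :
    ∑ k, F k = ∑ k, F (liftIndex u k) :=
  (Equiv.sum_comp _ F).symm

theorem seifert_map_liftLetter (u : List (Fin r × ℤˣ))
    (x y : Fin (u.map liftLetter).length → ℂ) :
    seifert (u.map liftLetter) x y = seifert u (restrictLift u x) (restrictLift u y) := by
  unfold seifert
  rw [sum_fin_map]
  refine Finset.sum_congr rfl fun k _ => ?_
  rw [sum_fin_map]
  refine Finset.sum_congr rfl fun l _ => ?_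
  have : (⟨r + 1, u.map liftLetter⟩ : ClosedBraid).linking (liftIndex u k)
      (liftIndex u l) = (⟨r, u⟩ : ClosedBraid).linking k l := by
    simp only [linking, pos, sgn, Matrix.of_apply, get_map_liftLetter, liftLetter, Fin.ext_iff,
      Fin.lt_def, val_liftIndex, Fin.val_castSucc]
    split_ifs <;> simp_all
  rw [this]
  rfl

theorem flux_map_liftLetter_castSucc (u : List (Fin r × ℤˣ))
    (x : Fin (u.map liftLetter).length → ℂ) (i : Fin r) :
    flux (u.map liftLetter) x i.castSucc = flux u (restrictLift u x) i := by
  rw [flux_apply, flux_apply, sum_fin_map]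
  refine Finset.sum_congr rfl fun k _ => ?_
  simp [restrictLift, liftLetter, liftIndex, LinearEquiv.funCongrLeft_apply,
    LinearMap.funLeft_apply]

theorem flux_map_liftLetter_last (u : List (Fin r × ℤˣ))
    (x : Fin (u.map liftLetter).length → ℂ) :
    flux (u.map liftLetter) x (Fin.last r) = 0 := by
  rw [flux_apply, sum_fin_map]
  refine Finset.sum_eq_zero fun k _ => ?_
  simp [liftLetter, liftIndex, (Fin.castSucc_lt_last _).ne]

/-- A cycle vanishes on a band which is the only one of its position. -/
theorem signatureAt_stab (ω : ℂ) (u : List (Fin r × ℤˣ)) (ε : ℤˣ) :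
    signatureAt ω ⟨r, u⟩ = signatureAt ω ⟨r + 1, u.map liftLetter ++ [(Fin.last r, ε)]⟩ := by
  have hright : ∀ y ∈ (⟨r + 1, u.map liftLetter ++ [(Fin.last r, ε)]⟩ : ClosedBraid).homology,
      right (u.map liftLetter) [(Fin.last r, ε)] y = 0 := by
    intro y hy
    rw [mem_homology_iff, flux_append] at hy
    have h := congrFun hy (Fin.last r)
    rw [Pi.add_apply, flux_map_liftLetter_last, zero_add, flux_singleton, Pi.single_eq_same] at h
    funext k
    rw [show k = (0 : Fin 1) from Subsingleton.elim (α := Fin 1) k 0]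
    exact h
  let T : (Fin u.length → ℂ) →ₗ[ℂ] (Fin (u.map liftLetter ++ [(Fin.last r, ε)]).length → ℂ) :=
    { toFun := fun x => join (u.map liftLetter) [(Fin.last r, ε)] ((restrictLift u).symm x) 0
      map_add' := fun x y => by
        apply join_ext
        · simp
        · rw [right_join, map_add (right _ _), right_join, right_join, add_zero]
      map_smul' := fun c x => by
        apply join_ext
        · simp
        · rw [RingHom.id_apply, right_join, map_smul (right _ _), right_join, smul_zero] }
  have hTl : ∀ x, left (u.map liftLetter) [(Fin.last r, ε)] (T x) = (restrictLift u).symm x :=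
    fun x => left_join _ _ _ _
  have hTr : ∀ x, right (u.map liftLetter) [(Fin.last r, ε)] (T x) = 0 :=
    fun x => right_join _ _ _ _
  refine hermitianSignature_eq_of_seifert ω (star_mem_homology _) (star_mem_homology _) T
    ((restrictLift u).toLinearMap ∘ₗ left _ _) ?_ (fun _ => rfl) ?_ ?_ ?_ ?_
  · intro x
    apply join_ext
    · rw [left_star, hTl, hTl]
      rfl
    · rw [right_star, hTr, hTr, star_zero]
  · intro x hx
    rw [mem_homology_iff] at hx ⊢
    rw [flux_append, hTl, hTr, map_zero, add_zero]
    funext i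
    refine Fin.lastCases ?_ (fun i => ?_) i
    · exact flux_map_liftLetter_last u _
    · rw [flux_map_liftLetter_castSucc, LinearEquiv.apply_symm_apply, hx]
      rfl
  · intro y hy
    have hr := hright y hy
    rw [mem_homology_iff] at hy ⊢
    rw [flux_append, hr, map_zero, add_zero] at hy
    funext i
    have h := congrFun hy i.castSucc
    rw [flux_map_liftLetter_castSucc] at h
    exact h
  · intro x _ y _
    simp only [seifert_append, hTl, hTr, seifert_map_liftLetter, LinearEquiv.apply_symm_apply,
      map_zero, crossing_zero_right, zero_dotProduct, zero_div, add_zero, sub_zero,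
      seifert_zero_left]
  · intro x hx y hy
    simp only [seifert_append, hright x hx, hright y hy, map_zero, crossing_zero_right,
      zero_dotProduct, zero_div, add_zero, sub_zero, seifert_map_liftLetter, seifert_zero_left]
    rfl

/-! ### Cancellation -/

/-- The vector that runs up a first band and down a second one in the same position is isotropic
if the two crossings have opposite signs, and its orthogonal complement consists of the vectors
whose weights on the two bands add up to zero. -/
theorem signatureAt_cancel {ω : ℂ} (hω : ω ≠ 1) (u v : List (Fin r × ℤˣ)) (i : Fin r) (ε : ℤˣ) :
    signatureAt ω ⟨r, u ++ [(i, ε), (i, -ε)] ++ v⟩ = signatureAt ω ⟨r, u ++ v⟩ := by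
  have hs0 : flux [(i, ε), (i, -ε)] ![1, -1] = 0 := by
    rw [flux_pair]
    simp [← Pi.single_add]
  -- The middle part of a vector, as a vector of length two.
  let m : (Fin (u ++ [(i, ε), (i, -ε)] ++ v).length → ℂ) →ₗ[ℂ] (Fin 2 → ℂ) :=
    right u [(i, ε), (i, -ε)] ∘ₗ left (u ++ [(i, ε), (i, -ε)]) v
  let e : Fin (u ++ [(i, ε), (i, -ε)] ++ v).length → ℂ :=
    join (u ++ [(i, ε), (i, -ε)]) v (join u [(i, ε), (i, -ε)] 0 ![1, -1]) 0
  have he1 : left (u ++ [(i, ε), (i, -ε)]) v e = join u [(i, ε), (i, -ε)] 0 ![1, -1] :=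
    left_join _ _ _ _
  have he2 : right (u ++ [(i, ε), (i, -ε)]) v e = 0 := right_join _ _ _ _
  have heZ : e ∈ (⟨r, u ++ [(i, ε), (i, -ε)] ++ v⟩ : ClosedBraid).homology := by
    rw [mem_homology_iff, flux_append, he1, he2, flux_append, left_join, right_join, hs0]
    simp
  have hestar : star e = e := by
    apply join_ext
    · rw [left_star, he1, ← join_star]
      congr 1
      · simp
      · funext k
        fin_cases k <;> simp
    · rw [right_star, he2, star_zero]
  have hSl : ∀ x, seifert (u ++ [(i, ε), (i, -ε)] ++ v) e x =
      (1 - (ε : ℤ)) / 2 * (m x 0 + m x 1) := by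
    intro x
    simp only [seifert_append, he1, he2, flux_append, left_join, right_join, hs0, map_zero,
      add_zero, zero_add, sub_zero, crossing_zero_left, zero_dotProduct, zero_div,
      seifert_zero_left]
    refine (seifert_pair _ _ ![1, -1] (m x)).trans ?_
    simp [coeffBefore, coeffAfter]
    ring
  have hSr : ∀ x, seifert (u ++ [(i, ε), (i, -ε)] ++ v) x e =
      -(1 + (ε : ℤ)) / 2 * (m x 0 + m x 1) := by
    intro x
    simp only [seifert_append, he1, he2, flux_append, left_join, right_join, hs0, map_zero,
      add_zero, zero_add, sub_zero, crossing_zero_right, dotProduct_zero, zero_div,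
      seifert_zero_right]
    refine (seifert_pair _ _ (m x) ![1, -1]).trans ?_
    simp [coeffBefore, coeffAfter]
    ring
  have hh : ∀ x, star e ⬝ᵥ ((⟨r, u ++ [(i, ε), (i, -ε)] ++ v⟩ : ClosedBraid).hermitianMatrix ω *ᵥ
      x) = 0 ↔ m x 0 + m x 1 = 0 := by
    intro x
    rw [form_hermitianMatrix, hestar, hSl, hSr]
    have h1 : 1 - ω ≠ 0 := sub_ne_zero.2 hω.symm
    have h2 : 1 - conj ω ≠ 0 := by
      rw [← map_one (starRingEnd ℂ), ← map_sub]
      exact (map_ne_zero _).2 h1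
    have hε : ((ε : ℤ) : ℂ) = 1 ∨ ((ε : ℤ) : ℂ) = -1 := by
      rcases Int.units_eq_one_or ε with h | h <;> simp [h]
    rcases hε with h | h
    · rw [h, sub_self, zero_div, zero_mul, mul_zero, zero_add, mul_eq_zero_iff_left h2,
        mul_eq_zero_iff_left (by norm_num)]
    · rw [h, add_neg_cancel, neg_zero, zero_div, zero_mul, mul_zero, add_zero,
        mul_eq_zero_iff_left h1, mul_eq_zero_iff_left (by norm_num)]
  have hm : ∀ x, m x 0 + m x 1 = 0 → flux [(i, ε), (i, -ε)] (m x) = 0 := by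
    intro x hx
    rw [flux_pair]
    simp [← Pi.single_add, hx]
  rw [signatureAt, ← hermitianSignature_orthogonalWithin (hermitianMatrix_isHermitian _ ω) heZ
    ((hh e).2 (by
      change right u [(i, ε), (i, -ε)] (left (u ++ [(i, ε), (i, -ε)]) v e) 0 +
        right u [(i, ε), (i, -ε)] (left (u ++ [(i, ε), (i, -ε)]) v e) 1 = 0
      rw [he1, right_join]
      simp))]
  have key : hermitianSignature ((⟨r, u ++ [(i, ε), (i, -ε)] ++ v⟩ : ClosedBraid).hermitianMatrix ω)
      (orthogonalWithin ((⟨r, u ++ [(i, ε), (i, -ε)] ++ v⟩ : ClosedBraid).hermitianMatrix ω)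
        (⟨r, u ++ [(i, ε), (i, -ε)] ++ v⟩ : ClosedBraid).homology e) =
      signatureAt ω ⟨r, u ++ [] ++ v⟩ := by
    refine hermitianSignature_eq_of_seifert ω ?_ (star_mem_homology _)
      (replaceMiddle u v 0) (replaceMiddle u v 0)
      (replaceMiddle_star u v 0 fun _ => funext fun k => k.elim0)
      (replaceMiddle_star u v 0 fun a => by simp)
      ?_ ?_ ?_ ?_
    · intro x hx
      rw [mem_orthogonalWithin, hh] at hx ⊢
      refine ⟨star_mem_homology _ x hx.1, ?_⟩
      have := congrArg star hx.2
      rw [star_add, star_zero] at this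
      exact this
    · intro x hx
      rw [mem_orthogonalWithin, hh] at hx
      have h := hx.1
      rw [mem_homology_iff] at h ⊢
      rw [flux_replaceMiddle, h]
      exact (hm x hx.2).symm
    · intro y hy
      rw [mem_homology_iff] at hy
      rw [mem_orthogonalWithin, hh, mem_homology_iff, flux_replaceMiddle, hy]
      · refine ⟨rfl, ?_⟩
        change right u [(i, ε), (i, -ε)] (left (u ++ [(i, ε), (i, -ε)]) v _) 0 +
          right u [(i, ε), (i, -ε)] (left (u ++ [(i, ε), (i, -ε)]) v _) 1 = 0
        rw [left_replaceMiddle, right_join]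
        simp
      · rw [LinearMap.zero_apply, map_zero, flux_nil]
    · intro x hx y hy
      rw [mem_orthogonalWithin, hh] at hx hy
      apply seifert_replaceMiddle
      · exact (hm x hx.2).symm
      · exact (hm y hy.2).symm
      · refine Eq.trans ?_ (seifert_pair _ _ (m x) (m y)).symm
        rw [eq_neg_of_add_eq_zero_right hx.2, eq_neg_of_add_eq_zero_right hy.2]
        simp [seifert, coeffBefore, coeffAfter]
        ring
    · intro x hx y hy
      apply seifert_replaceMiddle
      · rw [LinearMap.zero_apply, map_zero, flux_nil]
      · rw [LinearMap.zero_apply, map_zero, flux_nil]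
      · simp [seifert]
  rw [key, List.append_nil]

theorem signatureAt_eq_of_isotopic {ω : ℂ} (hω : ω ≠ 1) {β γ : ClosedBraid}
    (h : β.Isotopic γ) : signatureAt ω β = signatureAt ω γ := by
  induction h with
  | rel _ _ h =>
    rcases h with ⟨r, u, v, i, ε⟩ | ⟨r, u, v, i, j, ε, δ, hij⟩ | ⟨r, u, v, i, j, hij⟩ | ⟨r, u, a⟩ |
      ⟨r, u, ε⟩
    · exact signatureAt_cancel hω u v i ε
    · exact signatureAt_comm ω u v i j ε δ hij
    · exact signatureAt_braid ω u v i j hij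
    · exact signatureAt_append_comm ω [a] u
    · exact signatureAt_stab ω u ε
  | refl _ => rfl
  | symm _ _ _ ih => exact ih.symm
  | trans _ _ _ _ _ ih1 ih2 => exact ih1.trans ih2

end Invariance

end ClosedBraid

/-! ### Character sums -/

/-- The sum of the powers of a `q`-th root of unity. -/
theorem sum_pow_of_pow_eq_one {q : ℕ} {z : ℂ} (hz : z ^ q = 1) :
    ∑ j ∈ Finset.range q, z ^ j = if z = 1 then (q : ℂ) else 0 := by
  split_ifs with h
  · simp [h]
  · rw [geom_sum_eq h, hz, sub_self, zero_div]

theorem sum_lt_pow_mul_pow {q : ℕ} {z w : ℂ} (hz : z ^ q = 1) (hw : w ^ q = 1) (hz1 : z ≠ 1)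
    (hw1 : w ≠ 1) :
    ∑ j : Fin q, ∑ j' : Fin q, (if j < j' then (1 : ℂ) else 0) * (z ^ (j : ℕ) * w ^ (j' : ℕ)) =
      (if z * w = 1 then (q : ℂ) else 0) / (z - 1) := by
  have hz0 : z - 1 ≠ 0 := sub_ne_zero.2 hz1
  rw [Finset.sum_comm]
  have hin : ∀ j' : Fin q, ∑ j : Fin q,
      (if j < j' then (1 : ℂ) else 0) * (z ^ (j : ℕ) * w ^ (j' : ℕ)) =
      ((z * w) ^ (j' : ℕ) - w ^ (j' : ℕ)) / (z - 1) := by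
    intro j'
    have h1 : ∑ j : Fin q, (if j < j' then (1 : ℂ) else 0) * (z ^ (j : ℕ) * w ^ (j' : ℕ)) =
        (∑ j ∈ Finset.range j', z ^ j) * w ^ (j' : ℕ) := by
      simp only [Fin.lt_def]
      rw [Fin.sum_univ_eq_sum_range
        (fun j => (if j < (j' : ℕ) then (1 : ℂ) else 0) * (z ^ j * w ^ (j' : ℕ))) q,
        Finset.sum_mul]
      simp only [ite_mul, one_mul, zero_mul]
      rw [← Finset.sum_filter]
      refine Finset.sum_congr ?_ fun _ _ => rfl
      ext k
      simp only [Finset.mem_filter, Finset.mem_range]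
      omega
    rw [h1, geom_sum_eq hz1, mul_pow]
    ring
  rw [Finset.sum_congr rfl fun j' _ => hin j', ← Finset.sum_div, Finset.sum_sub_distrib,
    Fin.sum_univ_eq_sum_range (fun j => (z * w) ^ j), Fin.sum_univ_eq_sum_range (fun j => w ^ j),
    sum_pow_of_pow_eq_one hw, sum_pow_of_pow_eq_one (by rw [mul_pow, hz, hw, one_mul]), if_neg hw1,
    sub_zero]

theorem sum_bidiagonal {n : ℕ} {z w : ℂ} (hz : z ^ (n + 1) = 1) (hw : w ^ (n + 1) = 1)
    (hz1 : z ≠ 1) :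
    ∑ i : Fin n, ∑ i' : Fin n, (if i = i' then (1 : ℂ) else if (i : ℕ) = i' + 1 then -1 else 0) *
      ((z ^ ((i : ℕ) + 1) - 1) * (w ^ ((i' : ℕ) + 1) - 1)) =
      (1 - z) * (if z * w = 1 then ((n + 1 : ℕ) : ℂ) else 0) := by
  rw [Finset.sum_comm]
  have hin : ∀ i' : Fin n, ∑ i : Fin n,
      (if i = i' then (1 : ℂ) else if (i : ℕ) = i' + 1 then -1 else 0) *
        ((z ^ ((i : ℕ) + 1) - 1) * (w ^ ((i' : ℕ) + 1) - 1)) =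
      (1 - z) * ((z * w) ^ ((i' : ℕ) + 1) - z ^ ((i' : ℕ) + 1)) := by
    intro i'
    -- The vector `z ^ (i + 1) - 1` vanishes at `i = n`, so that the last row is no exception.
    have h1 : ∑ i : Fin n, (if i = i' then (1 : ℂ) else if (i : ℕ) = i' + 1 then -1 else 0) *
        ((z ^ ((i : ℕ) + 1) - 1) * (w ^ ((i' : ℕ) + 1) - 1)) =
        ∑ i ∈ Finset.range (n + 1), ((if i = i' then (z ^ (i + 1) - 1) * (w ^ ((i' : ℕ) + 1) - 1)
          else 0) - (if i = i' + 1 then (z ^ (i + 1) - 1) * (w ^ ((i' : ℕ) + 1) - 1) else 0)) := by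
      rw [Finset.sum_range_succ, hz, sub_self, zero_mul, ite_self, ite_self, sub_zero, add_zero,
        ← Fin.sum_univ_eq_sum_range (fun i => ((if i = i' then
          (z ^ (i + 1) - 1) * (w ^ ((i' : ℕ) + 1) - 1) else 0) -
          (if i = i' + 1 then (z ^ (i + 1) - 1) * (w ^ ((i' : ℕ) + 1) - 1) else 0))) n]
      refine Finset.sum_congr rfl fun i _ => ?_
      simp only [Fin.ext_iff]
      split_ifs
      · omega
      · ring
      · ring
      · ring
    rw [h1, Finset.sum_sub_distrib, Finset.sum_ite_eq', Finset.sum_ite_eq',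
      if_pos (Finset.mem_range.2 (by omega)), if_pos (Finset.mem_range.2 (by omega))]
    ring
  rw [Finset.sum_congr rfl fun i' _ => hin i', ← Finset.mul_sum, Finset.sum_sub_distrib,
    Fin.sum_univ_eq_sum_range (fun i => (z * w) ^ (i + 1)),
    Fin.sum_univ_eq_sum_range (fun i => z ^ (i + 1))]
  have h2 := Finset.sum_range_succ' (fun i => (z * w) ^ i) n
  have h3 := Finset.sum_range_succ' (fun i => z ^ i) n
  rw [sum_pow_of_pow_eq_one (by rw [mul_pow, hz, hw, one_mul])] at h2
  rw [sum_pow_of_pow_eq_one hz, if_neg hz1] at h3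
  rw [h2]
  simp only [pow_zero] at h3 ⊢
  linear_combination (1 - z) * h3

namespace ClosedBraid

section Torus

/-- The braid word `(σ₁ ⋯ σₙ)^q`. -/
def torusWord (n q : ℕ) : List (Fin n × ℤˣ) :=
  (List.replicate q (List.ofFn fun i : Fin n => (i, (1 : ℤˣ)))).flatten

variable (n q : ℕ)

theorem length_torusWord : q * n = (torusWord n q).length := by
  simp [torusWord]

/-- The bands of the torus link, as pairs of a repetition of `σ₁ ⋯ σₙ` and a position. -/
def torusIndex : Fin q × Fin n ≃ Fin (torusWord n q).length :=
  finProdFinEquiv.trans (finCongr (length_torusWord n q))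

theorem val_torusIndex (a : Fin q × Fin n) : (torusIndex n q a : ℕ) = a.2 + n * a.1 := rfl

theorem getElem?_flatten_replicate {α : Type*} (l : List α) :
    ∀ (q i j : ℕ), i < l.length → j < q →
      (List.replicate q l).flatten[i + l.length * j]? = l[i]? := by
  intro q
  induction q with
  | zero => intro i j _ hj; omega
  | succ q ih =>
    intro i j hi hj
    rw [List.replicate_succ, List.flatten_cons]
    cases j with
    | zero => rw [mul_zero, add_zero, List.getElem?_append_left hi]
    | succ j =>
      rw [List.getElem?_append_right (by rw [mul_add]; omega), ← ih i j hi (by omega)]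
      congr 1
      rw [mul_add]; omega

theorem get_torusWord (a : Fin q × Fin n) :
    (torusWord n q).get (torusIndex n q a) = (a.2, 1) := by
  have h := getElem?_flatten_replicate (List.ofFn fun i : Fin n => (i, (1 : ℤˣ))) q a.2 a.1
    (by simp) a.1.2
  rw [List.length_ofFn, ← val_torusIndex n q a] at h
  change (torusWord n q)[(torusIndex n q a : ℕ)]? = _ at h
  rw [List.getElem?_eq_getElem (torusIndex n q a).2, List.getElem?_eq_getElem (by simp)] at h
  simpa using h

theorem torusIndex_lt_iff (a b : Fin q × Fin n) :
    torusIndex n q a < torusIndex n q b ↔ a.1 < b.1 ∨ a.1 = b.1 ∧ a.2 < b.2 := by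
  rw [Fin.lt_def, val_torusIndex, val_torusIndex, Fin.lt_def, Fin.ext_iff, Fin.lt_def]
  have h1 := a.2.2
  have h2 := b.2.2
  rcases lt_trichotomy (a.1 : ℕ) b.1 with h | h | h
  · have : n * (a.1 + 1) ≤ n * b.1 := Nat.mul_le_mul_left n h
    rw [mul_add] at this
    simp only [h, h.ne, false_and, or_false, iff_true]
    omega
  · simp [h]
  · have : n * (b.1 + 1) ≤ n * a.1 := Nat.mul_le_mul_left n h
    rw [mul_add] at this
    simp only [h.not_gt, h.ne', false_and, or_false, iff_false]
    omega

theorem linking_torusIndex (a b : Fin q × Fin n) :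
    ((⟨n, torusWord n q⟩ : ClosedBraid).linking (torusIndex n q a) (torusIndex n q b) : ℂ) =
      (if a.2 = b.2 then (1 : ℂ) else if (a.2 : ℕ) = b.2 + 1 then -1 else 0) *
        (if a.1 < b.1 then 1 else 0) - (if a.2 = b.2 then 1 / 2 else 0) := by
  have hpos : ∀ a, (⟨n, torusWord n q⟩ : ClosedBraid).pos (torusIndex n q a) = a.2 :=
    fun a => congrArg Prod.fst (get_torusWord n q a)
  have hsgn : ∀ a, (⟨n, torusWord n q⟩ : ClosedBraid).sgn (torusIndex n q a) = 1 :=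
    fun a => congrArg Prod.snd (get_torusWord n q a)
  rcases lt_trichotomy (torusIndex n q a) (torusIndex n q b) with h | h | h
  · rw [linking_of_lt _ h, hpos, hpos, coeffBefore]
    rw [torusIndex_lt_iff] at h
    rcases h with h | ⟨h1, h2⟩
    · simp only [h, if_true, mul_one]
      split_ifs <;> norm_num
    · have h3 : (a.2 : ℕ) ≠ b.2 + 1 := by rw [Fin.lt_def] at h2; omega
      simp [h1, h2.ne, h3]
  · obtain rfl := (torusIndex n q).injective h
    rw [linking_self, hsgn]
    simp
  · rw [linking_of_gt _ h, hpos, hpos, coeffAfter]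
    rw [torusIndex_lt_iff] at h
    have h1 : ¬ a.1 < b.1 := by
      rcases h with h | ⟨h, -⟩
      · exact h.not_gt
      · exact h.not_gt
    simp only [h1, if_false, mul_zero, zero_sub]
    split_ifs <;> simp

/-- The vector on the bands of a torus link with the coordinates `u i * f j`. -/
def torusVector (u : Fin n → ℂ) (f : Fin q → ℂ) : Fin (torusWord n q).length → ℂ :=
  fun k => u ((torusIndex n q).symm k).2 * f ((torusIndex n q).symm k).1

variable {n q}

theorem torusVector_torusIndex (u : Fin n → ℂ) (f : Fin q → ℂ) (a : Fin q × Fin n) :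
    torusVector n q u f (torusIndex n q a) = u a.2 * f a.1 := by
  simp [torusVector]

theorem star_torusVector (u : Fin n → ℂ) (f : Fin q → ℂ) :
    star (torusVector n q u f) = torusVector n q (star u) (star f) := by
  funext k
  simp [torusVector]

theorem flux_torusWord (x : Fin (torusWord n q).length → ℂ) (i : Fin n) :
    flux (torusWord n q) x i = ∑ j, x (torusIndex n q (j, i)) := by
  rw [flux_apply, ← Equiv.sum_comp (torusIndex n q), Fintype.sum_prod_type]
  refine Finset.sum_congr rfl fun j _ => ?_
  simp only [get_torusWord]
  rw [Finset.sum_ite_eq']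
  simp

theorem torusVector_mem_homology (u : Fin n → ℂ) {f : Fin q → ℂ} (hf : ∑ j, f j = 0) :
    torusVector n q u f ∈ (⟨n, torusWord n q⟩ : ClosedBraid).homology := by
  rw [mem_homology_iff]
  funext i
  rw [flux_torusWord]
  simp [torusVector_torusIndex, ← Finset.mul_sum, hf]

/-- On the cycles, the Seifert pairing of a torus link is a tensor product. -/
theorem seifert_torusVector (u u' : Fin n → ℂ) {f : Fin q → ℂ} (f' : Fin q → ℂ)
    (hf : ∑ j, f j = 0) :
    seifert (torusWord n q) (torusVector n q u f) (torusVector n q u' f') =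
      (∑ i : Fin n, ∑ i' : Fin n, (if i = i' then (1 : ℂ) else if (i : ℕ) = i' + 1 then -1 else 0) *
        (u i * u' i')) * ∑ j, ∑ j', (if j < j' then (1 : ℂ) else 0) * (f j * f' j') := by
  unfold seifert
  rw [← Equiv.sum_comp (torusIndex n q), Fintype.sum_prod_type]
  simp only [← Equiv.sum_comp (torusIndex n q), Fintype.sum_prod_type, torusVector_torusIndex,
    linking_torusIndex]
  have h0 : ∑ j, ∑ i, ∑ j', ∑ i', u i * f j * (if i = i' then (1 / 2 : ℂ) else 0) *
      (u' i' * f' j') = 0 := by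
    calc _ = ∑ j, f j * ∑ i, ∑ j', ∑ i', u i * (if i = i' then (1 / 2 : ℂ) else 0) *
          (u' i' * f' j') := by
          simp only [Finset.mul_sum]
          refine Finset.sum_congr rfl fun _ _ => Finset.sum_congr rfl fun _ _ =>
            Finset.sum_congr rfl fun _ _ => Finset.sum_congr rfl fun _ _ => by ring
      _ = 0 := by rw [← Finset.sum_mul, hf, zero_mul]
  calc _ = (∑ j, ∑ i : Fin n, ∑ j', ∑ i' : Fin n,
          (if i = i' then (1 : ℂ) else if (i : ℕ) = i' + 1 then -1 else 0) * (u i * u' i') *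
          ((if j < j' then (1 : ℂ) else 0) * (f j * f' j'))) -
          ∑ j, ∑ i, ∑ j', ∑ i', u i * f j * (if i = i' then (1 / 2 : ℂ) else 0) *
            (u' i' * f' j') := by
        simp only [← Finset.sum_sub_distrib]
        refine Finset.sum_congr rfl fun _ _ => Finset.sum_congr rfl fun _ _ =>
            Finset.sum_congr rfl fun _ _ => Finset.sum_congr rfl fun _ _ => by ring
    _ = _ := by
        rw [h0, sub_zero, Finset.sum_mul_sum, Finset.sum_comm]
        refine Finset.sum_congr rfl fun i _ => Finset.sum_congr rfl fun j _ => ?_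
        rw [Finset.sum_mul_sum, Finset.sum_comm]

/-- The cycles of a torus link are determined by their values on all repetitions but one. -/
theorem finrank_homology_torusWord_le (n m : ℕ) :
    Module.finrank ℂ (⟨n, torusWord n (m + 1)⟩ : ClosedBraid).homology ≤ n * m := by
  let T : (⟨n, torusWord n (m + 1)⟩ : ClosedBraid).homology →ₗ[ℂ] (Fin m × Fin n → ℂ) :=
    LinearMap.funLeft ℂ ℂ (fun a : Fin m × Fin n => torusIndex n (m + 1) (a.1.succ, a.2)) ∘ₗ
      Submodule.subtype _
  have hT : Function.Injective T := by
    rw [← LinearMap.ker_eq_bot, LinearMap.ker_eq_bot']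
    rintro ⟨x, hx⟩ h
    have h1 : ∀ j i, x (torusIndex n (m + 1) (Fin.succ j, i)) = 0 := fun j i => congrFun h (j, i)
    rw [mem_homology_iff] at hx
    have h0 : ∀ i, x (torusIndex n (m + 1) (0, i)) = 0 := by
      intro i
      have h2 := congrFun hx i
      rw [flux_torusWord, Fin.sum_univ_succ, Finset.sum_eq_zero fun j _ => h1 j i, add_zero] at h2
      exact h2
    ext k
    obtain ⟨⟨j, i⟩, rfl⟩ := (torusIndex n (m + 1)).surjective k
    exact Fin.cases (h0 i) (fun j => h1 j i) j
  have := LinearMap.finrank_le_finrank_of_injective hT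
  simpa [mul_comm] using this

/-- The vector with the coordinates `(z ^ (i + 1) - 1) * s ^ j`. -/
noncomputable def eigenvector (n q : ℕ) (z s : ℂ) : Fin (torusWord n q).length → ℂ :=
  torusVector n q (fun i => z ^ ((i : ℕ) + 1) - 1) (fun j => s ^ (j : ℕ))

theorem star_eigenvector (z s : ℂ) : star (eigenvector n q z s) =
    eigenvector n q (conj z) (conj s) := by
  rw [eigenvector, star_torusVector, eigenvector]
  congr 1 <;> funext k <;> simp

theorem eigenvector_mem_homology {z s : ℂ} (hs : s ^ q = 1) (hs1 : s ≠ 1) :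
    eigenvector n q z s ∈ (⟨n, torusWord n q⟩ : ClosedBraid).homology := by
  apply torusVector_mem_homology
  rw [Fin.sum_univ_eq_sum_range (fun j => s ^ j), sum_pow_of_pow_eq_one hs, if_neg hs1]

theorem seifert_eigenvector {z s w t : ℂ} (hz : z ^ (n + 1) = 1) (hz1 : z ≠ 1)
    (hs : s ^ q = 1) (hs1 : s ≠ 1) (hw : w ^ (n + 1) = 1) (ht : t ^ q = 1) (ht1 : t ≠ 1) :
    seifert (torusWord n q) (eigenvector n q z s) (eigenvector n q w t) =
      (1 - z) * (if z * w = 1 then ((n + 1 : ℕ) : ℂ) else 0) *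
        ((if s * t = 1 then (q : ℂ) else 0) / (s - 1)) := by
  rw [eigenvector, eigenvector, seifert_torusVector, sum_bidiagonal hz hw hz1,
    sum_lt_pow_mul_pow hs ht hs1 ht1]
  rw [Fin.sum_univ_eq_sum_range (fun j => s ^ j), sum_pow_of_pow_eq_one hs, if_neg hs1]

end Torus

end ClosedBraid

/-! ### The values of the form on the eigenvectors -/

theorem one_sub_exp_two_mul_I (α : ℝ) :
    1 - Complex.exp (2 * α * Complex.I) =
      -2 * Complex.I * Real.sin α * Complex.exp (α * Complex.I) := by
  have h1 : Complex.exp (2 * α * Complex.I) =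
      Complex.exp (α * Complex.I) * Complex.exp (α * Complex.I) := by
    rw [← Complex.exp_add]; ring_nf
  have h2 : Complex.exp (-α * Complex.I) * Complex.exp (α * Complex.I) = 1 := by
    rw [← Complex.exp_add, ← add_mul, neg_add_cancel, zero_mul, Complex.exp_zero]
  rw [Complex.ofReal_sin, Complex.sin, h1]
  linear_combination (Complex.exp (α * Complex.I) * (Complex.exp (-α * Complex.I) -
    Complex.exp (α * Complex.I))) * Complex.I_sq - h2

/-- All factors are of the form `1 - exp (2iα)`, so that the argument of the
quotient is, up to right angles, the signed sum of the half angles. -/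
theorem re_one_sub_exp_mul_div (α β γ : ℝ) (hγ : Real.sin γ ≠ 0) :
    ((1 - Complex.exp (2 * α * Complex.I)) * (1 - Complex.exp (2 * (-β : ℝ) * Complex.I)) /
      (Complex.exp (2 * (-γ : ℝ) * Complex.I) - 1)).re =
      -2 * (Real.sin α * Real.sin β / Real.sin γ) * Real.sin (α - β + γ) := by
  have hγ' : (Real.sin γ : ℂ) ≠ 0 := by exact_mod_cast hγ
  have h3 : Complex.exp (2 * (-γ : ℝ) * Complex.I) - 1 =
      -2 * Complex.I * Real.sin γ * Complex.exp ((-γ : ℝ) * Complex.I) := by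
    rw [← neg_sub, one_sub_exp_two_mul_I, Real.sin_neg]
    push_cast; ring
  have h4 : Complex.exp (((α - β + γ : ℝ) : ℂ) * Complex.I) *
      Complex.exp ((-γ : ℝ) * Complex.I) =
      Complex.exp (α * Complex.I) * Complex.exp ((-β : ℝ) * Complex.I) := by
    rw [← Complex.exp_add, ← Complex.exp_add]
    congr 1
    push_cast; ring
  have key : (1 - Complex.exp (2 * α * Complex.I)) *
      (1 - Complex.exp (2 * (-β : ℝ) * Complex.I)) /
      (Complex.exp (2 * (-γ : ℝ) * Complex.I) - 1) =
      ((2 * (Real.sin α * Real.sin β / Real.sin γ) : ℝ) : ℂ) *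
        (Complex.I * Complex.exp (((α - β + γ : ℝ) : ℂ) * Complex.I)) := by
    rw [one_sub_exp_two_mul_I, one_sub_exp_two_mul_I, h3, Real.sin_neg]
    rw [div_eq_iff (by
      refine mul_ne_zero (mul_ne_zero ?_ hγ') (Complex.exp_ne_zero _)
      simp)]
    have hP : ((Real.sin α * Real.sin β / Real.sin γ : ℝ) : ℂ) * Real.sin γ =
        Real.sin α * Real.sin β := by
      rw [← Complex.ofReal_mul, div_mul_cancel₀ _ hγ, Complex.ofReal_mul]
    rw [Complex.ofReal_mul, Complex.ofReal_ofNat, Complex.ofReal_neg (Real.sin β)]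
    linear_combination (4 * Complex.I ^ 2 * Real.sin α * Real.sin β) * h4 +
      (4 * Complex.I ^ 2 * Complex.exp (((α - β + γ : ℝ) : ℂ) * Complex.I) *
        Complex.exp ((-γ : ℝ) * Complex.I)) * hP
  rw [key, Complex.re_ofReal_mul, Complex.I_mul_re, Complex.exp_ofReal_mul_I_im]
  ring

namespace ClosedBraid

section Torus

theorem conj_mul_eq_one_iff {z w : ℂ} (hz : ‖z‖ = 1) : conj z * w = 1 ↔ w = z := by
  have h : z * conj z = 1 := by rw [Complex.mul_conj, Complex.normSq_eq_norm_sq, hz]; simp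
  constructor
  · intro h1
    calc w = (z * conj z) * w := by rw [h, one_mul]
      _ = z := by rw [mul_assoc, h1, mul_one]
  · rintro rfl
    rw [mul_comm, h]

/-- The `k`-th power of the standard primitive `m`-th root of unity. -/
noncomputable def rootOfUnity (m k : ℕ) : ℂ := Complex.exp (2 * Real.pi * Complex.I / m) ^ k

theorem rootOfUnity_eq_exp (m k : ℕ) :
    rootOfUnity m k = Complex.exp (2 * (Real.pi * (k / m) : ℝ) * Complex.I) := by
  rw [rootOfUnity, ← Complex.exp_nat_mul]
  congr 1
  push_cast; ring

theorem conj_rootOfUnity_eq_exp (m k : ℕ) :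
    conj (rootOfUnity m k) = Complex.exp (2 * (-(Real.pi * (k / m)) : ℝ) * Complex.I) := by
  have h2 : conj (2 : ℂ) = 2 := map_ofNat _ 2
  rw [rootOfUnity_eq_exp, ← Complex.exp_conj]
  congr 1
  simp [h2]

theorem rootOfUnity_pow {m : ℕ} (hm : m ≠ 0) (k : ℕ) : rootOfUnity m k ^ m = 1 := by
  rw [rootOfUnity, pow_right_comm, (Complex.isPrimitiveRoot_exp m hm).pow_eq_one, one_pow]

theorem norm_rootOfUnity (m k : ℕ) : ‖rootOfUnity m k‖ = 1 := by
  rw [rootOfUnity_eq_exp, ← Complex.norm_exp_ofReal_mul_I (2 * (Real.pi * (k / m)))]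
  push_cast; rfl

theorem rootOfUnity_ne_one {m k : ℕ} (hk : 0 < k) (hkm : k < m) : rootOfUnity m k ≠ 1 :=
  (Complex.isPrimitiveRoot_exp m (by omega)).pow_ne_one_of_pos_of_lt hk.ne' hkm

theorem rootOfUnity_inj {m k l : ℕ} (hk : k < m) (hl : l < m)
    (h : rootOfUnity m k = rootOfUnity m l) :
    k = l :=
  (Complex.isPrimitiveRoot_exp m (by omega)).pow_inj hk hl h

theorem conj_pow_eq_one {z : ℂ} {m : ℕ} (hz : z ^ m = 1) : conj z ^ m = 1 := by
  rw [← map_pow, hz, map_one]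

theorem conj_ne_one {z : ℂ} (hz : z ≠ 1) : conj z ≠ 1 := by
  rwa [Ne, map_eq_one_iff _ (RingHom.injective _)]

theorem form_eigenvector_of_ne {n q c a c' a' : ℕ} (ω : ℂ)
    (hc : 0 < c) (hcn : c < n + 1) (ha : 0 < a) (haq : a < q)
    (hc' : 0 < c') (hcn' : c' < n + 1) (ha' : 0 < a') (haq' : a' < q)
    (hne : (c, a) ≠ (c', a')) :
    star (eigenvector n q (rootOfUnity (n + 1) c) (rootOfUnity q a)) ⬝ᵥ
      ((⟨n, torusWord n q⟩ : ClosedBraid).hermitianMatrix ω *ᵥ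
        eigenvector n q (rootOfUnity (n + 1) c') (rootOfUnity q a')) = 0 := by
  have hz := rootOfUnity_pow n.succ_ne_zero c
  have hw := rootOfUnity_pow n.succ_ne_zero c'
  have hs := rootOfUnity_pow (m := q) (by omega) a
  have ht := rootOfUnity_pow (m := q) (by omega) a'
  have hzero : conj (rootOfUnity (n + 1) c) * rootOfUnity (n + 1) c' ≠ 1 ∨
      conj (rootOfUnity q a) * rootOfUnity q a' ≠ 1 := by
    rw [Ne, Ne, conj_mul_eq_one_iff (norm_rootOfUnity _ _),
      conj_mul_eq_one_iff (norm_rootOfUnity _ _)]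
    by_contra! h
    exact hne (by rw [rootOfUnity_inj hcn' hcn h.1, rootOfUnity_inj haq' haq h.2])
  rw [form_hermitianMatrix, star_eigenvector,
    seifert_eigenvector (conj_pow_eq_one hz) (conj_ne_one (rootOfUnity_ne_one hc hcn))
      (conj_pow_eq_one hs) (conj_ne_one (rootOfUnity_ne_one ha haq)) hw ht
      (rootOfUnity_ne_one ha' haq'),
    seifert_eigenvector hw (rootOfUnity_ne_one hc' hcn') ht (rootOfUnity_ne_one ha' haq')
      (conj_pow_eq_one hz) (conj_pow_eq_one hs) (conj_ne_one (rootOfUnity_ne_one ha haq)),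
    mul_comm (rootOfUnity (n + 1) c'), mul_comm (rootOfUnity q a')]
  rcases hzero with h | h <;> simp [h]

theorem form_eigenvector_self {n q c a : ℕ} (x : ℝ)
    (hc : 0 < c) (hcn : c < n + 1) (ha : 0 < a) (haq : a < q) :
    (star (eigenvector n q (rootOfUnity (n + 1) c) (rootOfUnity q a)) ⬝ᵥ
      ((⟨n, torusWord n q⟩ : ClosedBraid).hermitianMatrix
          (Complex.exp (2 * (Real.pi * x : ℝ) * Complex.I)) *ᵥ
        eigenvector n q (rootOfUnity (n + 1) c) (rootOfUnity q a))).re =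
      -(4 * (n + 1) * q) * (Real.sin (Real.pi * x) * Real.sin (Real.pi * (c / (n + 1 : ℕ))) /
        Real.sin (Real.pi * (a / q))) *
        Real.sin (Real.pi * x - Real.pi * (c / (n + 1 : ℕ)) + Real.pi * (a / q)) := by
  have hz := rootOfUnity_pow n.succ_ne_zero c
  have hs := rootOfUnity_pow (m := q) (by omega) a
  have hq0 : (0 : ℝ) < q := by exact_mod_cast (by omega : 0 < q)
  have hsin : Real.sin (Real.pi * (a / q)) ≠ 0 := by
    refine (Real.sin_pos_of_pos_of_lt_pi (by positivity) ?_).ne'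
    have : (a / q : ℝ) < 1 := by rw [div_lt_one hq0]; exact_mod_cast haq
    nlinarith [Real.pi_pos]
  have hre := re_one_sub_exp_mul_div (Real.pi * x) (Real.pi * (c / (n + 1 : ℕ)))
    (Real.pi * (a / q)) hsin
  rw [← conj_rootOfUnity_eq_exp, ← conj_rootOfUnity_eq_exp] at hre
  set ω := Complex.exp (2 * (Real.pi * x : ℝ) * Complex.I)
  have h1 := (conj_mul_eq_one_iff (norm_rootOfUnity (n + 1) c)).2 rfl
  have h2 := (conj_mul_eq_one_iff (norm_rootOfUnity q a)).2 rfl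
  rw [form_hermitianMatrix, star_eigenvector,
    seifert_eigenvector (conj_pow_eq_one hz) (conj_ne_one (rootOfUnity_ne_one hc hcn))
      (conj_pow_eq_one hs) (conj_ne_one (rootOfUnity_ne_one ha haq)) hz hs
      (rootOfUnity_ne_one ha haq),
    seifert_eigenvector hz (rootOfUnity_ne_one hc hcn) hs (rootOfUnity_ne_one ha haq)
      (conj_pow_eq_one hz) (conj_pow_eq_one hs) (conj_ne_one (rootOfUnity_ne_one ha haq)),
    mul_comm (rootOfUnity (n + 1) c), mul_comm (rootOfUnity q a), if_pos h1, if_pos h2]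
  set z := rootOfUnity (n + 1) c
  set s := rootOfUnity q a
  set R := (1 - ω) * (1 - conj z) / (conj s - 1) with hR
  have e : (1 - ω) * ((1 - conj z) * ((n + 1 : ℕ) : ℂ) * ((q : ℂ) / (conj s - 1))) +
      (1 - conj ω) * ((1 - z) * ((n + 1 : ℕ) : ℂ) * ((q : ℂ) / (s - 1))) =
      (((n + 1) * q : ℝ) : ℂ) * (R + conj R) := by
    rw [hR, map_div₀, map_mul, map_sub, map_sub, map_sub, map_one, Complex.conj_conj,
      Complex.conj_conj]
    push_cast
    ring
  rw [e, Complex.re_ofReal_mul, Complex.add_re, Complex.conj_re, hre]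
  ring

/-- The eigenvectors on which the Hermitian form at `exp (2πix)` is seen to be negative give an
upper bound for the signature. -/
theorem signatureAt_torusWord_le (n m : ℕ) {x : ℝ} (hx0 : 0 < x) (hx1 : x < 1)
    (F : Finset (ℕ × ℕ))
    (hF : ∀ s ∈ F, 0 < s.1 ∧ s.1 < n + 1 ∧ 0 < s.2 ∧ s.2 < m + 1 ∧
      (s.1 : ℝ) / (n + 1 : ℕ) < x + s.2 / (m + 1 : ℕ) ∧
      x + (s.2 : ℝ) / (m + 1 : ℕ) < 1 + s.1 / (n + 1 : ℕ)) :
    signatureAt (Complex.exp (2 * (Real.pi * x : ℝ) * Complex.I)) ⟨n, torusWord n (m + 1)⟩ ≤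
      n * m - 2 * F.card := by
  set ω := Complex.exp (2 * (Real.pi * x : ℝ) * Complex.I) with hω
  have h1 := positiveIndex_add_positiveIndex_neg_le
    ((⟨n, torusWord n (m + 1)⟩ : ClosedBraid).hermitianMatrix ω)
    (⟨n, torusWord n (m + 1)⟩ : ClosedBraid).homology
  have h2 := finrank_homology_torusWord_le n m
  have h3 : Fintype.card F ≤ positiveIndex
      (-(⟨n, torusWord n (m + 1)⟩ : ClosedBraid).hermitianMatrix ω)
      (⟨n, torusWord n (m + 1)⟩ : ClosedBraid).homology := by
    refine card_le_positiveIndex_of_orthogonal (κ := F)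
      (v := fun s => eigenvector n (m + 1) (rootOfUnity (n + 1) s.1.1)
        (rootOfUnity (m + 1) s.1.2)) ?_ ?_ ?_
    · rintro ⟨s, hs⟩
      obtain ⟨-, -, h3, h4, -⟩ := hF s hs
      exact eigenvector_mem_homology (rootOfUnity_pow m.succ_ne_zero _)
        (rootOfUnity_ne_one h3 h4)
    · rintro ⟨s, hs⟩ ⟨t, ht⟩ hst
      obtain ⟨h1, h2, h3, h4, -⟩ := hF s hs
      obtain ⟨h1', h2', h3', h4', -⟩ := hF t ht
      rw [Matrix.neg_mulVec, dotProduct_neg, form_eigenvector_of_ne ω h1 h2 h3 h4 h1' h2' h3' h4'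
        (fun h => hst (Subtype.ext h)), neg_zero]
    · rintro ⟨s, hs⟩
      obtain ⟨h1, h2, h3, h4, h5, h6⟩ := hF s hs
      have hsin : ∀ t : ℝ, 0 < t → t < 1 → 0 < Real.sin (Real.pi * t) := fun t h0 h1 =>
        Real.sin_pos_of_pos_of_lt_pi (by positivity) (by nlinarith [Real.pi_pos])
      have hp : (0 : ℝ) < (n + 1 : ℕ) := by positivity
      have hq : (0 : ℝ) < (m + 1 : ℕ) := by positivity
      have h1' : (0 : ℝ) < s.1 := by exact_mod_cast h1
      have h3' : (0 : ℝ) < s.2 := by exact_mod_cast h3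
      have s1 := hsin x hx0 hx1
      have s2 := hsin (s.1 / (n + 1 : ℕ)) (by positivity)
        ((div_lt_one hp).2 (by exact_mod_cast h2))
      have s3 := hsin (s.2 / (m + 1 : ℕ)) (by positivity)
        ((div_lt_one hq).2 (by exact_mod_cast h4))
      have s4 := hsin (x - s.1 / (n + 1 : ℕ) + s.2 / (m + 1 : ℕ)) (by linarith) (by linarith)
      rw [neg_form_re, form_eigenvector_self x h1 h2 h3 h4]
      rw [mul_add, mul_sub] at s4
      have := mul_pos (mul_pos (show (0 : ℝ) < 4 * (n + 1) * (m + 1 : ℕ) by positivity)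
        (div_pos (mul_pos s1 s2) s3)) s4
      linarith
  rw [Fintype.card_coe] at h3
  unfold signatureAt hermitianSignature
  have : positiveIndex ((⟨n, torusWord n (m + 1)⟩ : ClosedBraid).hermitianMatrix ω)
      (⟨n, torusWord n (m + 1)⟩ : ClosedBraid).homology + F.card + F.card ≤ n * m + positiveIndex
      (-(⟨n, torusWord n (m + 1)⟩ : ClosedBraid).hermitianMatrix ω)
      (⟨n, torusWord n (m + 1)⟩ : ClosedBraid).homology := by omega
  zify at this
  linarith

end Torus

end ClosedBraid

/-! ### Counting lattice points -/

/-- The pairs `(c, a)` of exponents whose eigenvectors are negative for the form at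
`exp (2πix)`. -/
noncomputable def negativePairs (n m : ℕ) (x : ℝ) : Finset (ℕ × ℕ) :=
  (Finset.Icc 1 n ×ˢ Finset.Icc 1 m).filter fun s =>
    (s.1 : ℝ) / (n + 1 : ℕ) < x + s.2 / (m + 1 : ℕ) ∧
      x + (s.2 : ℝ) / (m + 1 : ℕ) < 1 + s.1 / (n + 1 : ℕ)

/-- For a fixed `y`, at most `(m + 1) |y - x|` of the fractions `a / (m + 1)` are exceptional. The
two conditions exclude each other: the first one needs `x < y`, the second one `y < x`. -/
theorem card_exceptional_le (m : ℕ) (x y : ℝ) :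
    (((Finset.Icc 1 m).filter fun a : ℕ =>
      ¬ (y < x + (a : ℝ) / (m + 1 : ℕ) ∧ x + (a : ℝ) / (m + 1 : ℕ) < 1 + y)).card : ℝ) ≤
      (m + 1 : ℕ) * |y - x| := by
  have hq : (0 : ℝ) < (m + 1 : ℕ) := by positivity
  rcases le_total x y with h | h
  · rw [abs_of_nonneg (sub_nonneg.2 h)]
    have hsub : ((Finset.Icc 1 m).filter fun a : ℕ =>
        ¬ (y < x + (a : ℝ) / (m + 1 : ℕ) ∧ x + (a : ℝ) / (m + 1 : ℕ) < 1 + y)) ⊆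
        Finset.Icc 1 ⌊((m + 1 : ℕ) : ℝ) * (y - x)⌋₊ := by
      intro a ha
      rw [Finset.mem_filter, Finset.mem_Icc] at ha
      obtain ⟨⟨h1, h2⟩, h3⟩ := ha
      have h4 : (a : ℝ) / (m + 1 : ℕ) < 1 := by
        rw [div_lt_one hq]; exact_mod_cast Nat.lt_succ_of_le h2
      have h5 : (a : ℝ) / (m + 1 : ℕ) ≤ y - x := by
        by_contra! h6
        exact h3 ⟨by linarith, by linarith⟩
      rw [div_le_iff₀' hq] at h5
      exact Finset.mem_Icc.2 ⟨h1, Nat.le_floor h5⟩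
    have hcard := Finset.card_le_card hsub
    rw [Nat.card_Icc, Nat.add_sub_cancel] at hcard
    exact (Nat.cast_le.2 hcard).trans (Nat.floor_le (mul_nonneg hq.le (sub_nonneg.2 h)))
  · rw [abs_of_nonpos (sub_nonpos.2 h), neg_sub]
    have hsub : ((Finset.Icc 1 m).filter fun a : ℕ =>
        ¬ (y < x + (a : ℝ) / (m + 1 : ℕ) ∧ x + (a : ℝ) / (m + 1 : ℕ) < 1 + y)) ⊆
        (Finset.Icc 1 ⌊((m + 1 : ℕ) : ℝ) * (x - y)⌋₊).image fun b => m + 1 - b := by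
      intro a ha
      rw [Finset.mem_filter, Finset.mem_Icc] at ha
      obtain ⟨⟨h1, h2⟩, h3⟩ := ha
      have h4 : 0 < (a : ℝ) / (m + 1 : ℕ) := div_pos (by exact_mod_cast h1) hq
      have h5 : 1 - (a : ℝ) / (m + 1 : ℕ) ≤ x - y := by
        by_contra! h6
        exact h3 ⟨by linarith, by linarith⟩
      have h6 : ((m + 1 - a : ℕ) : ℝ) ≤ (m + 1 : ℕ) * (x - y) := by
        rw [Nat.cast_sub (by omega)]
        calc ((m + 1 : ℕ) : ℝ) - a = (m + 1 : ℕ) * (1 - (a : ℝ) / (m + 1 : ℕ)) := by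
              field_simp
          _ ≤ _ := mul_le_mul_of_nonneg_left h5 hq.le
      exact Finset.mem_image.2 ⟨m + 1 - a, Finset.mem_Icc.2 ⟨by omega, Nat.le_floor h6⟩, by omega⟩
    have hcard := (Finset.card_le_card hsub).trans Finset.card_image_le
    rw [Nat.card_Icc, Nat.add_sub_cancel] at hcard
    exact (Nat.cast_le.2 hcard).trans (Nat.floor_le (mul_nonneg hq.le (sub_nonneg.2 h)))

theorem exists_card_negativePairs (n m : ℕ) (x : ℝ) : ∃ b : ℕ,
    (negativePairs n m x).card + b = n * m ∧
      (b : ℝ) ≤ (m + 1 : ℕ) * ∑ c ∈ Finset.range n, |((c + 1 : ℕ) : ℝ) / (n + 1 : ℕ) - x| := by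
  refine ⟨((Finset.Icc 1 n ×ˢ Finset.Icc 1 m).filter fun s : ℕ × ℕ =>
    ¬ ((s.1 : ℝ) / (n + 1 : ℕ) < x + s.2 / (m + 1 : ℕ) ∧
      x + (s.2 : ℝ) / (m + 1 : ℕ) < 1 + s.1 / (n + 1 : ℕ))).card, ?_, ?_⟩
  · rw [negativePairs, Finset.card_filter_add_card_filter_not]
    simp
  · rw [Finset.card_filter, Finset.sum_product]
    simp only [← Finset.card_filter]
    have hIcc : Finset.Icc 1 n = Finset.Ico 1 (n + 1) := by
      ext k
      simp only [Finset.mem_Icc, Finset.mem_Ico]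
      omega
    rw [hIcc, Finset.sum_Ico_eq_sum_range, Nat.add_sub_cancel, Nat.cast_sum, Finset.mul_sum]
    refine Finset.sum_le_sum fun c _ => ?_
    rw [add_comm 1 c]
    exact card_exceptional_le m x (((c + 1 : ℕ) : ℝ) / (n + 1 : ℕ))

/-- The sum of `|c / p - x|` over `0 < c < p` is at most `p ∫ |s - x| ds`, the integral being over
the unit interval, because `|s - x|` is convex in `s`. -/
theorem sum_abs_sub_le (n : ℕ) {x : ℝ} (hx0 : 1 / 3 ≤ x) (hx1 : x ≤ 1 / 2) :
    ∑ c ∈ Finset.range n, |((c + 1 : ℕ) : ℝ) / (n + 1 : ℕ) - x| ≤ (n + 1 : ℕ) * (5 / 18) := by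
  rcases Nat.eq_zero_or_pos n with rfl | hn
  · norm_num
  have hn' : (1 : ℝ) ≤ n := by exact_mod_cast hn
  have hp : (0 : ℝ) < (n + 1 : ℕ) := by positivity
  -- Twice an antiderivative of `|s - x|`, at the midpoints between the fractions `c / p`.
  let G : ℕ → ℝ := fun c =>
    ((c + 1 / 2) / (n + 1 : ℕ) - x) * |((c + 1 / 2) / (n + 1 : ℕ) - x : ℝ)|
  have hterm : ∀ t h : ℝ, 0 < h →
      2 * |t| * (2 * h) ≤ (t + h) * |t + h| - (t - h) * |t - h| := by
    intro t h hh
    rcases abs_cases t with ⟨h1, _⟩ | ⟨h1, _⟩ <;>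
      rcases abs_cases (t + h) with ⟨h2, _⟩ | ⟨h2, _⟩ <;>
      rcases abs_cases (t - h) with ⟨h3, _⟩ | ⟨h3, _⟩ <;> rw [h1, h2, h3] <;>
      nlinarith [sq_nonneg (t - h), sq_nonneg (t + h)]
  have hle : ∀ c ∈ Finset.range n, |((c + 1 : ℕ) : ℝ) / (n + 1 : ℕ) - x| ≤
      (n + 1 : ℕ) / 2 * (G (c + 1) - G c) := by
    intro c _
    have h := hterm (((c + 1 : ℕ) : ℝ) / (n + 1 : ℕ) - x) (1 / 2 / (n + 1 : ℕ)) (by positivity)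
    have e1 : ((c + 1 : ℕ) : ℝ) / (n + 1 : ℕ) - x + 1 / 2 / (n + 1 : ℕ) =
        (((c + 1 : ℕ) : ℝ) + 1 / 2) / (n + 1 : ℕ) - x := by ring
    have e2 : ((c + 1 : ℕ) : ℝ) / (n + 1 : ℕ) - x - 1 / 2 / (n + 1 : ℕ) =
        ((c : ℝ) + 1 / 2) / (n + 1 : ℕ) - x := by push_cast; ring
    rw [e1, e2] at h
    have h2 := mul_le_mul_of_nonneg_left h (show (0 : ℝ) ≤ (n + 1 : ℕ) / 2 by positivity)
    refine le_trans (le_of_eq ?_) h2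
    field_simp
  refine (Finset.sum_le_sum hle).trans ?_
  rw [← Finset.mul_sum, Finset.sum_range_sub]
  have hGn : G n ≤ (1 - x) ^ 2 := by
    have h1 : ((n : ℝ) + 1 / 2) / (n + 1 : ℕ) ≤ 1 := by
      rw [div_le_one hp]; push_cast; linarith
    have h2 : 1 / 2 ≤ ((n : ℝ) + 1 / 2) / (n + 1 : ℕ) := by
      rw [le_div_iff₀ hp]; push_cast; linarith
    simp only [G]
    rw [abs_of_nonneg (by linarith)]
    nlinarith
  have hG0 : -G 0 ≤ x ^ 2 := by
    have h1 : ((0 : ℕ) + 1 / 2 : ℝ) / (n + 1 : ℕ) ≤ 1 / 4 := by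
      rw [div_le_iff₀ hp]; push_cast; linarith
    have h2 : 0 ≤ ((0 : ℕ) + 1 / 2 : ℝ) / (n + 1 : ℕ) := by positivity
    simp only [G]
    rw [abs_of_nonpos (by linarith)]
    nlinarith
  have : G n - G 0 ≤ 5 / 9 := by nlinarith
  nlinarith

/-- At most `q ∑ |c / p - x|` exceptional pairs are few enough for signature at most `-4`. For
`p = 2` and for `(p, q) = (3, 4)` this needs that `b` is an integer. -/
theorem four_le_sub_of_le {p q b : ℕ} {x : ℝ} (hx0 : 1 / 3 ≤ x) (hx1 : x ≤ 1 / 2) (hp : 2 ≤ p)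
    (hpq : p < q) (hcop : Nat.Coprime p q) (h23 : ¬ (p = 2 ∧ q = 3))
    (hb : (b : ℝ) ≤ q * ∑ c ∈ Finset.range (p - 1), |((c + 1 : ℕ) : ℝ) / p - x|) :
    2 * b + 4 ≤ (p - 1) * (q - 1) := by
  have hq0 : (0 : ℝ) < q := by exact_mod_cast (by omega : 0 < q)
  have hcases : p = 2 ∨ p = 3 ∨ p = 4 ∨ p = 5 ∨ 6 ≤ p := by omega
  -- A rational bound `k / l` for the sum becomes an inequality between natural numbers.
  have key : ∀ k l : ℕ, (∑ c ∈ Finset.range (p - 1), |((c + 1 : ℕ) : ℝ) / p - x|) ≤ k / l →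
      0 < l → l * b ≤ k * q := by
    intro k l hR hl
    have hl' : (0 : ℝ) < l := by exact_mod_cast hl
    have h := hb.trans (mul_le_mul_of_nonneg_left hR hq0.le)
    rw [← mul_div_assoc, le_div_iff₀ hl'] at h
    have h' : ((l * b : ℕ) : ℝ) ≤ ((k * q : ℕ) : ℝ) := by push_cast; linarith
    exact_mod_cast h'
  rcases hcases with rfl | rfl | rfl | rfl | hp6
  · have := key 1 6 (by
      norm_num [Finset.sum_range_succ]
      rw [abs_le]; constructor <;> linarith) (by norm_num)
    have hq4 : q ≠ 4 := by rintro rfl; revert hcop; decide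
    have hq6 : q ≠ 6 := by rintro rfl; revert hcop; decide
    omega
  · have := key 1 3 (by
      norm_num [Finset.sum_range_succ]
      rw [abs_of_nonpos (by linarith), abs_of_nonneg (by linarith)]
      linarith) (by norm_num)
    omega
  · have := key 2 3 (by
      norm_num [Finset.sum_range_succ]
      rw [abs_of_nonpos (by linarith), abs_of_nonneg (by linarith), abs_of_nonneg (by linarith)]
      linarith) (by norm_num)
    omega
  · have := key 14 15 (by
      norm_num [Finset.sum_range_succ]
      rw [abs_of_nonpos (show 1 / 5 - x ≤ 0 by linarith),
        abs_of_nonneg (show 0 ≤ 3 / 5 - x by linarith),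
        abs_of_nonneg (show 0 ≤ 4 / 5 - x by linarith)]
      rcases abs_cases (2 / 5 - x) with ⟨h, _⟩ | ⟨h, _⟩ <;> rw [h] <;> linarith) (by norm_num)
    omega
  · obtain ⟨n, rfl⟩ : ∃ n, p = n + 1 := ⟨p - 1, by omega⟩
    rw [Nat.add_sub_cancel] at *
    have := key (5 * (n + 1)) 18 ((sum_abs_sub_le n hx0 hx1).trans (le_of_eq (by push_cast; ring)))
      (by norm_num)
    obtain ⟨m, rfl⟩ : ∃ m, q = m + 1 := ⟨q - 1, by omega⟩
    rw [Nat.add_sub_cancel]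
    nlinarith

namespace ClosedBraid

theorem torusKnot_isotopic_trivialKnot (q : ℕ) : (torusKnot 1 q).Isotopic trivialKnot := by
  have : torusKnot 1 q = trivialKnot := by
    have h : (List.replicate q ([] : List (Fin 0 × ℤˣ))).flatten = [] := by simp
    exact congrArg (ClosedBraid.mk 0) h
  rw [this]
  exact Relation.EqvGen.refl _

theorem signatureAt_torusKnot_le {p q : ℕ} {x : ℝ} (hx0 : 1 / 3 ≤ x) (hx1 : x ≤ 1 / 2)
    (hp : 2 ≤ p) (hpq : p < q) (hcop : Nat.Coprime p q) (h23 : ¬ (p = 2 ∧ q = 3)) :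
    signatureAt (Complex.exp (2 * (Real.pi * x : ℝ) * Complex.I)) (torusKnot p q) ≤ -4 := by
  obtain ⟨n, rfl⟩ : ∃ n, p = n + 1 := ⟨p - 1, by omega⟩
  obtain ⟨m, rfl⟩ : ∃ m, q = m + 1 := ⟨q - 1, by omega⟩
  obtain ⟨b, hb1, hb2⟩ := exists_card_negativePairs n m x
  have h1 := four_le_sub_of_le hx0 hx1 hp hpq hcop h23 (b := b) hb2
  have h2 := signatureAt_torusWord_le n m (x := x) (by linarith) (by linarith)
    (negativePairs n m x) (by
      intro s hs
      simp only [negativePairs, Finset.mem_filter, Finset.mem_product, Finset.mem_Icc] at hs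
      obtain ⟨⟨⟨h1, h2⟩, h3, h4⟩, h5, h6⟩ := hs
      exact ⟨h1, by omega, h3, by omega, h5, h6⟩)
  refine le_trans h2 ?_
  rw [Nat.add_sub_cancel, Nat.add_sub_cancel] at h1
  zify at h1 hb1
  linarith

end ClosedBraid

theorem proposition3p5 (p q : ℕ) (hp : 0 < p) (hpq : p < q) (hcop : Nat.Coprime p q)
    (htriv : ¬ (ClosedBraid.torusKnot p q).Isotopic ClosedBraid.trivialKnot)
    (htref : ¬ (ClosedBraid.torusKnot p q).Isotopic (ClosedBraid.torusKnot 2 3))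
    (d : ℕ) (hd : d.Prime) (K : ClosedBraid)
    (hK : K.Isotopic (ClosedBraid.torusKnot p q)) :
    K.tristramSignature d ≤ -4 := by
  have hp2 : 2 ≤ p := by
    rcases Nat.lt_or_ge 1 p with h | h
    · exact h
    · obtain rfl : p = 1 := by omega
      exact absurd (ClosedBraid.torusKnot_isotopic_trivialKnot q) htriv
  have h23 : ¬ (p = 2 ∧ q = 3) := by
    rintro ⟨rfl, rfl⟩
    exact htref (Relation.EqvGen.refl _)
  have hd2 := hd.two_le
  have hd0 : (0 : ℝ) < d := by exact_mod_cast (by omega : 0 < d)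
  set x : ℝ := ((d / 2 : ℕ) : ℝ) / d with hx
  have hx0 : 1 / 3 ≤ x := by
    rw [hx, le_div_iff₀ hd0]
    have : (d : ℝ) ≤ 3 * (d / 2 : ℕ) := by exact_mod_cast (by omega : d ≤ 3 * (d / 2))
    linarith
  have hx1 : x ≤ 1 / 2 := by
    rw [hx, div_le_iff₀ hd0]
    have : (2 : ℝ) * (d / 2 : ℕ) ≤ d := by exact_mod_cast (by omega : 2 * (d / 2) ≤ d)
    linarith
  have hω : Complex.exp (2 * Real.pi * Complex.I * ((d / 2 : ℕ) : ℂ) / (d : ℂ)) =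
      Complex.exp (2 * (Real.pi * x : ℝ) * Complex.I) := by
    congr 1
    rw [hx]
    push_cast
    ring
  have hω1 : Complex.exp (2 * (Real.pi * x : ℝ) * Complex.I) ≠ 1 := by
    have hsin : Real.sin (Real.pi * x) ≠ 0 :=
      (Real.sin_pos_of_pos_of_lt_pi (mul_pos Real.pi_pos (by linarith))
        (by nlinarith [Real.pi_pos])).ne'
    intro h
    have h2 := one_sub_exp_two_mul_I (Real.pi * x)
    rw [h, sub_self] at h2
    simp [hsin, -Complex.ofReal_sin] at h2
  have h := ClosedBraid.signatureAt_torusKnot_le hx0 hx1 hp2 hpq hcop h23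
  rw [← ClosedBraid.signatureAt_eq_of_isotopic hω1 hK] at h
  rw [ClosedBraid.tristramSignature, hω]
  exact h
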